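/- Theorem (range wedge counting). Let $G=(V,E)$ be a finite undirected simple graph with $m=|E|$ edges in which every vertex $v$ carries a real attribute $A_v$. For an interval $q=[x_1,x_2]$, a query asks for the number of wedges (subgraphs isomorphic to the path with two edges) in the subgraph of $G$ induced by the vertices $v$ with $x_1\le A_v\le x_2$. For every real $\lambda\in[1,\sqrt m]$ there is a data structure that occupies $\tilde O(m^2/\lambda^2)$ space and answers every query exactly in $\tilde O(\lambda)$ time, where $\tilde O$ hides a factor polylogarithmic in $m$. The computation model is the word RAM with words of $w\ge k\lceil\log_2(m+2)\rceil$ bits for a constant $k$, on which attribute values and interval endpoints are atomic reals that can only be moved and compared; space is the number of memory cells, time is the number of steps, and a single deterministic query program, the constant $k$ and all hidden constants are the same for all $G$, $A$, $\lambda$ and $w$. -/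

import Mathlib

/-! ### Range subgraph counting -/

/-- For a finite graph `G` whose vertices carry real attributes `A`, the number of occurrences of the
pattern `Q` (subgraphs isomorphic to `Q`) in the subgraph of `G` induced by the vertices whose
attribute lies in the interval `[x₁, x₂]`. -/
noncomputable def rangeSubgraphCount {V W : Type*} [Fintype V] (G : SimpleGraph V) (A : V → ℝ)
    (Q : SimpleGraph W) (x₁ x₂ : ℝ) : ℕ := by
  classical exact (G.induce {v : V | x₁ ≤ A v ∧ A v ≤ x₂}).copyCount Q

/-- A wedge is a path with two edges (and three vertices). -/
def wedge : SimpleGraph (Fin 3) := SimpleGraph.pathGraph 3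

/-! ### A word RAM

Words are `w`-bit integers, that is, natural numbers below `2 ^ w`. The memory has an array of words
and an array of real numbers. Real numbers are atomic: they can be moved and compared, but there is
no arithmetic on them and no conversion between reals and words. A program is a fixed finite text, so
it uses only a fixed finite number of registers. -/

namespace WordRAM

/-- The operations of the machine on words. -/
inductive BinOp
  | add
  | sub
  | mul
  | div
  | lt
  | eq

/-- The integer result of an operation, before reduction to `w` bits. Subtraction is truncated at
`0`, a quotient is rounded down, and a comparison yields `1` (true) or `0` (false). -/
def BinOp.eval : BinOp → ℕ → ℕ → ℕ
  | .add, a, b => a + b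
  | .sub, a, b => a - b
  | .mul, a, b => a * b
  | .div, a, b => a / b
  | .lt, a, b => if a < b then 1 else 0
  | .eq, a, b => if a = b then 1 else 0

/-- Word-valued expressions over literals and registers; `rle i j` tests whether the content of the
real register `i` is at most that of the real register `j`. -/
inductive Expr
  | lit (n : ℕ)
  | reg (i : ℕ)
  | op (o : BinOp) (e₁ e₂ : Expr)
  | rle (i j : ℕ)

/-- The state of the machine: word registers, real registers, word memory, real memory. -/
structure State where
  reg : ℕ → ℕ
  rreg : ℕ → ℝ
  mem : List ℕ
  rmem : List ℝ

/-- The value of an expression on a machine with `w`-bit words (arithmetic wraps around). -/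
noncomputable def Expr.eval (w : ℕ) (s : State) : Expr → ℕ
  | .lit n => n % 2 ^ w
  | .reg i => s.reg i
  | .op o e₁ e₂ => o.eval (e₁.eval w s) (e₂.eval w s) % 2 ^ w
  | .rle i j => open Classical in (if s.rreg i ≤ s.rreg j then 1 else 0) % 2 ^ w

/-- The number of steps for evaluating an expression: one for each of its nodes. -/
def Expr.cost : Expr → ℕ
  | .lit _ => 1
  | .reg _ => 1
  | .op _ e₁ e₂ => e₁.cost + e₂.cost + 1
  | .rle _ _ => 1

/-- Programs. -/
inductive Prog
  /-- do nothing -/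
  | skip
  /-- word register `i` := value of `e` -/
  | assign (i : ℕ) (e : Expr)
  /-- word register `i` := word memory at address `a` -/
  | load (i : ℕ) (a : Expr)
  /-- word memory at address `a` := value of `e` -/
  | store (a e : Expr)
  /-- real register `i` := real register `j` -/
  | rmove (i j : ℕ)
  /-- real register `i` := real memory at address `a` -/
  | rload (i : ℕ) (a : Expr)
  /-- real memory at address `a` := real register `i` -/
  | rstore (a : Expr) (i : ℕ)
  /-- run `p`, then `q` -/
  | seq (p q : Prog)
  /-- run `p` if the value of `e` is nonzero, and `q` otherwise -/
  | ite (e : Expr) (p q : Prog)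
  /-- run `p` as long as the value of `e` is nonzero -/
  | loop (e : Expr) (p : Prog)

/-- `Exec w p s s' t`: on a machine with `w`-bit words, the program `p` started in state `s` halts in
state `s'` after `t` steps. There is no rule for an access beyond the end of the memory: such a run
gets stuck. -/
inductive Exec (w : ℕ) : Prog → State → State → ℕ → Prop
  | skip (s : State) : Exec w .skip s s 1
  | assign (i : ℕ) (e : Expr) (s : State) :
      Exec w (.assign i e) s { s with reg := Function.update s.reg i (e.eval w s) } (e.cost + 1)
  | load (i : ℕ) (a : Expr) (s : State) (v : ℕ) (h : s.mem[a.eval w s]? = some v) :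
      Exec w (.load i a) s { s with reg := Function.update s.reg i v } (a.cost + 1)
  | store (a e : Expr) (s : State) (h : a.eval w s < s.mem.length) :
      Exec w (.store a e) s { s with mem := s.mem.set (a.eval w s) (e.eval w s) }
        (a.cost + e.cost + 1)
  | rmove (i j : ℕ) (s : State) :
      Exec w (.rmove i j) s { s with rreg := Function.update s.rreg i (s.rreg j) } 1
  | rload (i : ℕ) (a : Expr) (s : State) (v : ℝ) (h : s.rmem[a.eval w s]? = some v) :
      Exec w (.rload i a) s { s with rreg := Function.update s.rreg i v } (a.cost + 1)
  | rstore (a : Expr) (i : ℕ) (s : State) (h : a.eval w s < s.rmem.length) :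
      Exec w (.rstore a i) s { s with rmem := s.rmem.set (a.eval w s) (s.rreg i) } (a.cost + 1)
  | seq (p q : Prog) (s₁ s₂ s₃ : State) (t₁ t₂ : ℕ)
      (h₁ : Exec w p s₁ s₂ t₁) (h₂ : Exec w q s₂ s₃ t₂) :
      Exec w (.seq p q) s₁ s₃ (t₁ + t₂)
  | ite_true (e : Expr) (p q : Prog) (s s' : State) (t : ℕ) (he : e.eval w s ≠ 0)
      (h : Exec w p s s' t) : Exec w (.ite e p q) s s' (e.cost + 1 + t)
  | ite_false (e : Expr) (p q : Prog) (s s' : State) (t : ℕ) (he : e.eval w s = 0)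
      (h : Exec w q s s' t) : Exec w (.ite e p q) s s' (e.cost + 1 + t)
  | loop_done (e : Expr) (p : Prog) (s : State) (he : e.eval w s = 0) :
      Exec w (.loop e p) s s (e.cost + 1)
  | loop_step (e : Expr) (p : Prog) (s₁ s₂ s₃ : State) (t₁ t₂ : ℕ) (he : e.eval w s₁ ≠ 0)
      (h₁ : Exec w p s₁ s₂ t₁) (h₂ : Exec w (.loop e p) s₂ s₃ t₂) :
      Exec w (.loop e p) s₁ s₃ (e.cost + 1 + t₁ + t₂)

/-- A data structure stored in the memory of a machine with `w`-bit words. Cells that a query uses as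
working space are part of it. -/
structure DataStructure (w : ℕ) where
  words : List ℕ
  reals : List ℝ
  words_lt : ∀ a ∈ words, a < 2 ^ w

/-- The space of a data structure: its number of memory cells. -/
def DataStructure.space {w : ℕ} (D : DataStructure w) : ℕ := D.words.length + D.reals.length

/-- The start of a query `[x₁, x₂]`: the memory holds the data structure, the endpoints are in the real
registers `0` and `1`, and all other registers are `0`. -/
noncomputable def DataStructure.start {w : ℕ} (D : DataStructure w) (x₁ x₂ : ℝ) : State where
  reg := fun _ => 0
  rreg := fun i => if i = 0 then x₁ else if i = 1 then x₂ else 0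
  mem := D.words
  rmem := D.reals

/-- The query program `p`, run on the data structure `D` and the query `[x₁, x₂]`, halts after `t`
steps with the value `c` in the word register `0` and with the data structure as it was before the
query (so that the next query can be asked). -/
def DataStructure.Answers {w : ℕ} (D : DataStructure w) (p : Prog) (x₁ x₂ : ℝ) (c t : ℕ) : Prop :=
  ∃ s : State, Exec w p (D.start x₁ x₂) s t ∧ s.reg 0 = c ∧ s.mem = D.words ∧ s.rmem = D.reals

end WordRAM

/-! Sort the `2m` darts by the attribute of their source, keeping the darts of one vertex together
and ordering those by target. A query then becomes an interval `[a, b)` of positions, and a wedge in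
the induced subgraph is an unordered pair of darts with a common source such that both darts and
both reversals lie in `[a, b)`. The resulting count `wedges p q` makes sense for every interval,
even one that cuts through the darts of a single vertex.

Let `B = ⌊λ⌋`. The data structure stores `wedges` for all pairs of multiples of `B`, which takes
`O((m/λ)²)` cells; the remaining arrays take `O(m)` cells, and `m ≤ m²/λ²` because `λ² ≤ m`. A query
finds `a` and `b` by binary search, rounds them inward to multiples of `B`, looks up the count and
adds the at most `B` missing darts on each side one at a time. A new dart completes an edge only if
its reversal is already present, and then the count grows by the current degrees of the two
endpoints (`wedges_pred`, `wedges_succ`). Each degree costs `O(log m)`: among the darts of one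
source the reversals increase (`rev_mono_group`), so those lying in `[p, q)` together with their
reversals are consecutive, and two binary searches find the ends (`deg_eq_sub`). In total a query
takes `O(λ log m)` steps.

`exists_dartList` connects dart lists with copies of the wedge, and `runs_query` verifies the
program. -/

/-! ### Combinatorics of dart lists: how the wedge count changes dart by dart. -/

/-- The darts (oriented edges) of a graph whose vertices carry real keys, listed as `0, …, N - 1` in
the order of their source, with ties broken by their target. `rev` reverses a dart, and the darts with
the same source as `d` are those in `[fst d, lst d)`. -/
structure DartList where
  N : ℕ
  key : ℕ → ℝ
  rev : ℕ → ℕ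
  fst : ℕ → ℕ
  lst : ℕ → ℕ
  key_mono : ∀ i j, i ≤ j → j < N → key i ≤ key j
  rev_lt : ∀ d < N, rev d < N
  rev_rev : ∀ d < N, rev (rev d) = d
  fst_rev : ∀ d < N, fst (rev d) ≠ fst d
  lst_le : ∀ d < N, lst d ≤ N
  fst_eq_iff : ∀ d < N, ∀ d' < N, fst d' = fst d ↔ fst d ≤ d' ∧ d' < lst d
  rev_lt_rev : ∀ d d', d < d' → d' < N → fst d = fst d' → rev d < rev d'

namespace DartList

open Finset

variable (X : DartList)

/-- The darts of `S` whose reversal also lies in `S`. -/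
def inner (S : Finset ℕ) : Finset ℕ := S.filter fun d => X.rev d ∈ S

/-- The number of darts of `E` that have the same source as `d`. -/
def deg (E : Finset ℕ) (d : ℕ) : ℕ := #{x ∈ E | X.fst x = X.fst d}

/-- The number of unordered pairs of distinct darts of `E` with a common source. -/
def pairCount (E : Finset ℕ) : ℕ := ∑ x ∈ E, ∑ y ∈ E, if x < y ∧ X.fst x = X.fst y then 1 else 0

/-- The number of wedges of the graph formed by the edges with both darts in `[p, q)`. -/
def wedges (p q : ℕ) : ℕ := X.pairCount (X.inner (Ico p q))

lemma pairCount_insert {E : Finset ℕ} {a : ℕ} (ha : a ∉ E) :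
    X.pairCount (insert a E) = X.pairCount E + X.deg E a := by
  have h : X.deg E a = ∑ y ∈ E, ((if a < y ∧ X.fst a = X.fst y then 1 else 0) +
      if y < a ∧ X.fst y = X.fst a then 1 else 0) := by
    rw [deg, card_filter]
    refine sum_congr rfl fun y hy => ?_
    have : y ≠ a := fun h => ha (h ▸ hy)
    grind
  simp only [pairCount, sum_insert ha, sum_add_distrib] at h ⊢
  simp only [lt_self_iff_false, false_and, if_false]
  omega

lemma deg_insert_of_ne {E : Finset ℕ} {a b : ℕ} (h : X.fst a ≠ X.fst b) :
    X.deg (insert a E) b = X.deg E b := by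
  simp [deg, filter_insert, h]

lemma pairCount_le (E : Finset ℕ) : X.pairCount E ≤ #E * #E := by
  rw [pairCount, ← smul_eq_mul, ← sum_const]
  refine sum_le_sum fun x _ => ?_
  rw [← card_filter]
  exact card_filter_le _ _

lemma wedges_le {p q : ℕ} (h : q ≤ X.N) : X.wedges p q ≤ X.N * X.N := by
  refine (X.pairCount_le _).trans ?_
  have : #(X.inner (Ico p q)) ≤ X.N := (card_filter_le _ _).trans (by simp; omega)
  exact Nat.mul_le_mul this this

lemma inner_insert_of_rev_notMem {S : Finset ℕ} {d : ℕ} (hN : ∀ x ∈ S, x < X.N) (hd : d < X.N)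
    (h : X.rev d ∉ S) : X.inner (insert d S) = X.inner S := by
  have h1 := X.rev_rev
  have h2 := X.fst_rev d hd
  have h3 : X.rev d ≠ d := fun h => h2 (by rw [h])
  ext x
  simp only [inner, mem_filter, mem_insert]
  grind

lemma inner_insert_of_rev_mem {S : Finset ℕ} {d : ℕ} (hN : ∀ x ∈ S, x < X.N) (hd : d < X.N)
    (h : X.rev d ∈ S) : X.inner (insert d S) = insert d (insert (X.rev d) (X.inner S)) := by
  have h1 := X.rev_rev
  ext x
  simp only [inner, mem_filter, mem_insert]
  grind

/-- The edge completed by `d` contributes two darts with different sources. They form no pair with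
each other, so each adds the degree of its own source before the insertion. -/
lemma pairCount_inner_insert {S : Finset ℕ} {d : ℕ} (hN : ∀ x ∈ S, x < X.N) (hd : d < X.N)
    (hdS : d ∉ S) (h : X.rev d ∈ S) :
    X.pairCount (X.inner (insert d S)) =
      X.pairCount (X.inner S) + X.deg (X.inner S) d + X.deg (X.inner S) (X.rev d) := by
  have h2 := X.fst_rev d hd
  have h3 : X.rev d ≠ d := fun h => h2 (by rw [h])
  have h4 : X.rev d ∉ X.inner S := by simp [inner, X.rev_rev d hd, hdS]
  have h5 : d ∉ insert (X.rev d) (X.inner S) := by simp [inner, hdS, h3.symm]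
  rw [X.inner_insert_of_rev_mem hN hd h, pairCount_insert _ h5, pairCount_insert _ h4,
    deg_insert_of_ne _ h2]
  omega

/-- The change of the number of wedges when the dart `d` is added to `[p, q)`. -/
def gain (p q d : ℕ) : ℕ :=
  if p ≤ X.rev d ∧ X.rev d < q then
    X.deg (X.inner (Ico p q)) d + X.deg (X.inner (Ico p q)) (X.rev d) else 0

lemma pairCount_inner_insert_Ico {p q d : ℕ} (hq : q ≤ X.N) (hd : d < X.N) (h : d ∉ Ico p q) :
    X.pairCount (X.inner (insert d (Ico p q))) = X.wedges p q + X.gain p q d := by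
  have hN : ∀ x ∈ Ico p q, x < X.N := fun x hx => (mem_Ico.1 hx).2.trans_le hq
  by_cases hr : X.rev d ∈ Ico p q
  · rw [X.pairCount_inner_insert hN hd h hr, gain, if_pos (mem_Ico.1 hr), wedges]
    omega
  · rw [X.inner_insert_of_rev_notMem hN hd hr, gain, if_neg (by simpa using hr), wedges]
    rfl

lemma wedges_pred {p q : ℕ} (hq : q ≤ X.N) (hp : 0 < p) (hpq : p ≤ q) :
    X.wedges (p - 1) q = X.wedges p q + X.gain p q (p - 1) := by
  rw [← X.pairCount_inner_insert_Ico hq (by omega) (by simp; omega), wedges]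
  congr 2
  ext x; simp; omega

lemma wedges_succ {p q : ℕ} (hq : q < X.N) (hpq : p ≤ q) :
    X.wedges p (q + 1) = X.wedges p q + X.gain p q q := by
  rw [← X.pairCount_inner_insert_Ico hq.le hq (by simp), wedges]
  congr 2
  ext x; simp; omega

lemma wedges_self (p q : ℕ) (h : q ≤ p) : X.wedges p q = 0 := by
  simp [wedges, Ico_eq_empty_of_le h, inner, pairCount]

lemma fst_le {d : ℕ} (hd : d < X.N) : X.fst d ≤ d := ((X.fst_eq_iff d hd d hd).1 rfl).1

lemma lt_lst {d : ℕ} (hd : d < X.N) : d < X.lst d := ((X.fst_eq_iff d hd d hd).1 rfl).2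

/-- This makes the conditions "`v` or `rev v` is below `p`" and "`v` and `rev v` are below `q`"
downward closed within a group, as binary search requires. -/
lemma rev_mono_group {d v v' : ℕ} (hd : d < X.N) (h : X.fst d ≤ v) (hv : v ≤ v')
    (h' : v' < X.lst d) : X.rev v ≤ X.rev v' := by
  have hN := X.lst_le d hd
  rcases hv.eq_or_lt with rfl | hv
  · rfl
  · have h1 := (X.fst_eq_iff d hd v (by omega)).2 ⟨h, by omega⟩
    have h2 := (X.fst_eq_iff d hd v' (by omega)).2 ⟨by omega, h'⟩
    exact (X.rev_lt_rev v v' hv (by omega) (h1.trans h2.symm)).le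

/-- Here `l` is where a dart and its reversal have both reached `p`, and `l'` is where one of them
reaches `q`. The darts counted are those in `[l, l')`; if `l' < l` there are none, in agreement with
truncated subtraction. -/
lemma deg_eq_sub {p q d l l' : ℕ} (hq : q ≤ X.N) (hd : d < X.N)
    (hl : X.fst d ≤ l) (hl' : l' ≤ X.lst d)
    (h1 : ∀ v, X.fst d ≤ v → v < l → v < p ∨ X.rev v < p)
    (h2 : ∀ v, l ≤ v → v < X.lst d → p ≤ v ∧ p ≤ X.rev v)
    (h3 : ∀ v, X.fst d ≤ v → v < l' → v < q ∧ X.rev v < q)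
    (h4 : ∀ v, l' ≤ v → v < X.lst d → q ≤ v ∨ q ≤ X.rev v) :
    X.deg (X.inner (Ico p q)) d = l' - l := by
  rw [← Nat.card_Ico, deg]
  congr 1
  have hN := X.lst_le d hd
  ext x
  simp only [inner, mem_filter, mem_Ico]
  constructor
  · rintro ⟨⟨h5, h6⟩, h7⟩
    have := (X.fst_eq_iff d hd x (by omega)).1 h7
    constructor
    · by_contra! h
      have := h1 x this.1 h
      omega
    · by_contra! h
      have := h4 x h this.2
      omega
  · rintro ⟨h5, h6⟩
    have a := h2 x h5 (by omega)
    have b := h3 x (by omega) h6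
    exact ⟨⟨⟨a.1, b.1⟩, a.2, b.2⟩, (X.fst_eq_iff d hd x (by omega)).2 ⟨by omega, by omega⟩⟩

end DartList

/-! ### Copies of the wedge as a centre with two neighbours. -/

lemma nonempty_wedge_iso {U : Type*} {H : SimpleGraph U} {v x y : U} (h1 : H.Adj v x)
    (h2 : H.Adj v y) (hxy : x ≠ y) :
    Nonempty (wedge ≃g (H.subgraphOfAdj h1 ⊔ H.subgraphOfAdj h2).coe) := by
  have hvx := h1.ne
  have hvy := h2.ne
  have hmem : ∀ i : Fin 3, ![x, v, y] i ∈ (H.subgraphOfAdj h1 ⊔ H.subgraphOfAdj h2).verts := by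
    intro i
    fin_cases i <;> simp
  refine ⟨⟨Equiv.ofBijective (fun i : Fin 3 => ⟨![x, v, y] i, hmem i⟩) ⟨?_, ?_⟩, ?_⟩⟩
  · intro i j
    fin_cases i <;> fin_cases j <;> simp [hxy, hvx, hvy, hxy.symm, hvx.symm, hvy.symm]
  · rintro ⟨z, hz⟩
    have : z = x ∨ z = v ∨ z = y := by
      simp at hz
      tauto
    rcases this with rfl | rfl | rfl
    exacts [⟨0, rfl⟩, ⟨1, rfl⟩, ⟨2, rfl⟩]
  · intro i j
    change (H.subgraphOfAdj h1 ⊔ H.subgraphOfAdj h2).Adj (![x, v, y] i) (![x, v, y] j) ↔ _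
    fin_cases i <;> fin_cases j <;>
      simp [wedge, SimpleGraph.pathGraph_adj, hxy, hvx, hvy, hxy.symm, hvx.symm, hvy.symm]

/-- Used for surjectivity in `copyCount_wedge`: a copy of the wedge is recovered from its two edges.
Non-adjacency of `x` and `y` rules out a triangle. -/
lemma sup_subgraphOfAdj_eq {U : Type*} {H : SimpleGraph U} {v x y : U} (S : H.Subgraph)
    (hx : S.Adj v x) (hy : S.Adj v y) (hxy : ¬ S.Adj x y)
    (hS : ∀ z ∈ S.verts, z = x ∨ z = v ∨ z = y) :
    H.subgraphOfAdj hx.adj_sub ⊔ H.subgraphOfAdj hy.adj_sub = S := by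
  ext a b
  · simp only [SimpleGraph.Subgraph.verts_sup, SimpleGraph.subgraphOfAdj_verts, Set.mem_union,
      Set.mem_insert_iff, Set.mem_singleton_iff]
    constructor
    · rintro ((rfl | rfl) | (rfl | rfl))
      exacts [S.edge_vert hx, S.edge_vert hx.symm, S.edge_vert hy, S.edge_vert hy.symm]
    · intro h
      have := hS a h
      tauto
  · simp only [SimpleGraph.Subgraph.sup_adj, SimpleGraph.subgraphOfAdj_adj, Sym2.eq_iff]
    constructor
    · rintro ((⟨rfl, rfl⟩ | ⟨rfl, rfl⟩) | (⟨rfl, rfl⟩ | ⟨rfl, rfl⟩))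
      exacts [hx, hx.symm, hy, hy.symm]
    · intro h
      have ha := hS a (S.edge_vert h)
      have hb := hS b (S.edge_vert h.symm)
      have hab := h.ne
      rcases ha with rfl | rfl | rfl <;> rcases hb with rfl | rfl | rfl <;>
        first
        | exact absurd rfl hab
        | exact absurd h hxy
        | exact absurd h.symm hxy
        | simp

/-- The wedges of a graph correspond to a centre with an unordered pair of neighbours, which is
ordered by an injective labelling `τ`. -/
lemma copyCount_wedge {U : Type*} [Fintype U] (H : SimpleGraph U) (τ : U → ℕ)
    (hτ : Function.Injective τ) :
    H.copyCount wedge =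
      Nat.card {t : U × U × U // H.Adj t.1 t.2.1 ∧ H.Adj t.1 t.2.2 ∧ τ t.2.1 < τ t.2.2} := by
  classical
  have key : H.copyCount wedge = Nat.card {H' : H.Subgraph // Nonempty (wedge ≃g H'.coe)} := by
    rw [SimpleGraph.copyCount, Nat.card_eq_fintype_card, Fintype.card_subtype]
  rw [key]
  symm
  refine Nat.card_eq_of_bijective
    (fun t => ⟨H.subgraphOfAdj t.2.1 ⊔ H.subgraphOfAdj t.2.2.1, nonempty_wedge_iso _ _
      fun h => (t.2.2.2.ne (congrArg τ h))⟩) ⟨?_, ?_⟩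
  · rintro ⟨⟨v, x, y⟩, h1, h2, h3⟩ ⟨⟨v', x', y'⟩, h1', h2', h3'⟩ h
    simp only [Subtype.mk.injEq] at h
    have hadj := fun a b => congrArg (fun S : H.Subgraph => S.Adj a b) h
    simp only [SimpleGraph.Subgraph.sup_adj, SimpleGraph.subgraphOfAdj_adj, Sym2.eq_iff, eq_iff_iff]
      at hadj
    have hvx := h1.ne
    have hvy := h2.ne
    have hvx' := h1'.ne
    have hvy' := h2'.ne
    simp only at hvx hvy hvx' hvy' h3 h3'
    -- Both subgraphs have the same two edges. Their common endpoint determines the centre, and the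
    -- order of the labels determines which leaf comes first.
    have e1 := (hadj v x).1 (by simp)
    have e2 := (hadj v y).1 (by simp)
    have e3 := (hadj v' x').2 (by simp)
    have e4 := (hadj v' y').2 (by simp)
    simp only [Subtype.mk.injEq, Prod.mk.injEq]
    grind
  · rintro ⟨S, ⟨φ⟩⟩
    have a1 : S.Adj (φ 1) (φ 0) := by
      have := φ.map_adj_iff (v := 1) (w := 0)
      simpa [wedge, SimpleGraph.pathGraph_adj] using this
    have a2 : S.Adj (φ 1) (φ 2) := by
      have := φ.map_adj_iff (v := 1) (w := 2)
      simpa [wedge, SimpleGraph.pathGraph_adj] using this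
    have a3 : ¬ S.Adj (φ 0) (φ 2) := by
      have := φ.map_adj_iff (v := 0) (w := 2)
      simpa [wedge, SimpleGraph.pathGraph_adj] using this
    have hne : (φ 0 : U) ≠ φ 2 := by
      intro h
      have := φ.injective (Subtype.ext h)
      simp at this
    have hv : ∀ z ∈ S.verts, z = φ 0 ∨ z = φ 1 ∨ z = φ 2 := by
      intro z hz
      obtain ⟨i, hi⟩ := φ.surjective ⟨z, hz⟩
      have hi' : z = φ i := by rw [hi]
      fin_cases i
      exacts [.inl hi', .inr (.inl hi'), .inr (.inr hi')]
    rcases lt_or_gt_of_ne (fun h => hne (hτ h)) with h | h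
    · exact ⟨⟨(φ 1, φ 0, φ 2), a1.adj_sub, a2.adj_sub, h⟩,
        Subtype.ext (sup_subgraphOfAdj_eq S a1 a2 a3 hv)⟩
    · exact ⟨⟨(φ 1, φ 2, φ 0), a2.adj_sub, a1.adj_sub, h⟩,
        Subtype.ext (sup_subgraphOfAdj_eq S a2 a1 (fun h => a3 h.symm)
          fun z hz => by have := hv z hz; tauto)⟩

/-! ### Building the dart list of a graph with attributes. -/

/-- A labelling of the vertices along which the attribute does not decrease. -/
lemma exists_rank {V : Type*} [Fintype V] (A : V → ℝ) :
    ∃ ρ : V → ℕ, Function.Injective ρ ∧ ∀ u v, ρ u ≤ ρ v → A u ≤ A v := by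
  let e := Fintype.equivFin V
  let σ := Tuple.sort (A ∘ e.symm)
  refine ⟨fun v => σ.symm (e v), ?_, ?_⟩
  · intro u v h
    simpa using Fin.ext h
  · intro u v h
    have := Tuple.monotone_sort (A ∘ e.symm) (show σ.symm (e u) ≤ σ.symm (e v) from h)
    simpa [σ] using this

/-- A downward closed predicate holds exactly below some threshold. -/
lemma exists_threshold (N : ℕ) (P : ℕ → Prop) (h : ∀ i j, i ≤ j → j < N → P j → P i) :
    ∃ c ≤ N, ∀ d < N, d < c ↔ P d := by
  induction N with
  | zero => exact ⟨0, le_rfl, by simp⟩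
  | succ N ih =>
    by_cases hN : P N
    · exact ⟨N + 1, le_rfl, fun d hd => ⟨fun _ => h d N (by omega) (by omega) hN, fun _ => hd⟩⟩
    · obtain ⟨c, hc, hP⟩ := ih fun i j hij hj => h i j hij (by omega)
      refine ⟨c, by omega, fun d hd => ?_⟩
      rcases Nat.lt_succ_iff_lt_or_eq.1 hd with h' | rfl
      · exact hP d h'
      · exact iff_of_false (by omega) hN

/-- The darts of a graph, listed in lexicographic order of the labels of their endpoints. -/
lemma exists_dart_enumeration {V : Type*} [Fintype V] (G : SimpleGraph V) (ρ : V → ℕ)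
    (hρ : Function.Injective ρ) : ∃ f : Fin (2 * G.edgeSet.ncard) ≃ G.Dart, ∀ i j, i < j ↔
      ρ (f i).fst < ρ (f j).fst ∨ ρ (f i).fst = ρ (f j).fst ∧ ρ (f i).snd < ρ (f j).snd := by
  classical
  have hcard : Fintype.card G.Dart = 2 * G.edgeSet.ncard := by
    rw [G.dart_card_eq_twice_card_edges, ← G.coe_edgeFinset, Set.ncard_coe_finset]
  let e := (Fintype.equivFinOfCardEq hcard).symm
  let c : G.Dart → ℕ ×ₗ ℕ := fun d => toLex (ρ d.fst, ρ d.snd)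
  have hc : Function.Injective c := by
    intro d d' h
    simp only [c, EmbeddingLike.apply_eq_iff_eq, Prod.mk.injEq] at h
    exact SimpleGraph.Dart.ext _ _ (Prod.ext (hρ h.1) (hρ h.2))
  let f := (Tuple.sort (c ∘ e)).trans e
  have hf : StrictMono (c ∘ f) :=
    (Tuple.monotone_sort (c ∘ e)).strictMono_of_injective (hc.comp f.injective)
  refine ⟨f, fun i j => ?_⟩
  rw [← hf.lt_iff_lt]
  simp [c, Prod.Lex.toLex_lt_toLex]

open Finset in
lemma DartList.pairCount_eq_card (X : DartList) (E : Finset ℕ) : X.pairCount E =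
    Nat.card {z : ℕ × ℕ // z.1 ∈ E ∧ z.2 ∈ E ∧ z.1 < z.2 ∧ X.fst z.1 = X.fst z.2} := by
  rw [pairCount, ← sum_product', ← card_filter]
  symm
  apply Nat.subtype_card
  simp [and_assoc]

lemma rangeSubgraphCount_wedge {V : Type*} [Fintype V] (G : SimpleGraph V) (A : V → ℝ) (x₁ x₂ : ℝ)
    (ρ : V → ℕ) (hρ : Function.Injective ρ) :
    rangeSubgraphCount G A wedge x₁ x₂ =
      Nat.card {t : {v : V // x₁ ≤ A v ∧ A v ≤ x₂} × {v : V // x₁ ≤ A v ∧ A v ≤ x₂} ×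
        {v : V // x₁ ≤ A v ∧ A v ≤ x₂} //
          G.Adj t.1 t.2.1 ∧ G.Adj t.1 t.2.2 ∧ ρ t.2.1 < ρ t.2.2} := by
  unfold rangeSubgraphCount
  exact copyCount_wedge _ (fun v : {v : V | x₁ ≤ A v ∧ A v ≤ x₂} => ρ v) (hρ.comp Subtype.val_injective)

/-- The dart list of a graph whose vertices carry real attributes. -/
theorem exists_dartList {V : Type*} [Fintype V] (G : SimpleGraph V) (A : V → ℝ) :
    ∃ X : DartList, X.N = 2 * G.edgeSet.ncard ∧ ∀ x₁ x₂ : ℝ, ∀ a b : ℕ, a ≤ X.N → b ≤ X.N →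
      (∀ d < X.N, d < a ↔ X.key d < x₁) → (∀ d < X.N, d < b ↔ X.key d ≤ x₂) →
      X.wedges a b = rangeSubgraphCount G A wedge x₁ x₂ := by
  classical
  obtain ⟨ρ, hρ, hA⟩ := exists_rank A
  have henum := exists_dart_enumeration G ρ hρ
  generalize 2 * G.edgeSet.ncard = N at henum ⊢
  obtain ⟨f, hf⟩ := henum
  have hsrc : ∀ i j : Fin N, i ≤ j → ρ (f i).fst ≤ ρ (f j).fst := by
    intro i j h
    rcases h.eq_or_lt with rfl | h
    · rfl
    · rcases (hf i j).1 h with h | h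
      exacts [h.le, h.1.le]
  -- The limits of the group of `d`: sources are sorted by rank, so "source ranked strictly below"
  -- and "source ranked at most" each hold on an initial segment.
  have hthr : ∀ d : Fin N, ∃ c : ℕ × ℕ, c.1 ≤ N ∧ c.2 ≤ N ∧
      ∀ d' : Fin N, (c.1 ≤ d' ↔ ρ (f d).fst ≤ ρ (f d').fst) ∧
        ((d' : ℕ) < c.2 ↔ ρ (f d').fst ≤ ρ (f d).fst) := by
    intro d
    obtain ⟨c, hc, h⟩ := exists_threshold N
      (fun i => ∃ h : i < N, ρ (f ⟨i, h⟩).fst < ρ (f d).fst) fun i j hij hj ⟨_, h⟩ =>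
        ⟨by omega, (hsrc _ _ hij).trans_lt h⟩
    obtain ⟨c', hc', h'⟩ := exists_threshold N
      (fun i => ∃ h : i < N, ρ (f ⟨i, h⟩).fst ≤ ρ (f d).fst) fun i j hij hj ⟨_, h⟩ =>
        ⟨by omega, (hsrc _ _ hij).trans h⟩
    refine ⟨(c, c'), hc, hc', fun d' => ⟨?_, ?_⟩⟩
    · have := h d' d'.2
      simp only [d'.2, exists_true_left] at this
      rw [← not_lt, this, not_lt]
    · have := h' d' d'.2
      simpa only [d'.2, exists_true_left] using this
  choose c hc₁ hc₂ hc using hthr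
  let rv : Fin N → Fin N := fun d => f.symm (f d).symm
  have hrv : ∀ d, f (rv d) = (f d).symm := fun d => by simp [rv]
  have hself : ∀ d : Fin N, (c d).1 ≤ d := fun d => ((hc d d).1).2 le_rfl
  -- The left limit identifies the source, so it can serve as its name in the dart list.
  have hfst : ∀ d d' : Fin N, (c d').1 = (c d).1 ↔ (f d').fst = (f d).fst := by
    intro d d'
    constructor
    · intro h
      apply hρ
      have h1 := ((hc d d').1).1 (h ▸ hself d')
      have h2 := ((hc d' d).1).1 (h.symm ▸ hself d)
      exact le_antisymm h2 h1
    · intro h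
      have h1 := ((hc d' ⟨(c d).1, (hself d).trans_lt d.2⟩).1).2
        (by rw [h]; exact ((hc d _).1).1 le_rfl)
      have h2 := ((hc d ⟨(c d').1, (hself d').trans_lt d'.2⟩).1).2
        (by rw [← h]; exact ((hc d' _).1).1 le_rfl)
      exact le_antisymm h1 h2
  let X : DartList :=
    { N := N
      key := fun d => if h : d < N then A (f ⟨d, h⟩).fst else 0
      rev := fun d => if h : d < N then rv ⟨d, h⟩ else 0
      fst := fun d => if h : d < N then (c ⟨d, h⟩).1 else 0
      lst := fun d => if h : d < N then (c ⟨d, h⟩).2 else 0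
      key_mono := fun i j hij hj => by
        have hi : i < N := by omega
        simp only [hi, hj, dif_pos]
        exact hA _ _ (hsrc _ _ hij)
      rev_lt := fun d hd => by simp [hd]
      rev_rev := fun d hd => by
        simp only [hd, dif_pos, Fin.is_lt, Fin.eta]
        simp [rv]
      fst_rev := fun d hd => by
        simp only [hd, dif_pos, Fin.is_lt, Fin.eta, ne_eq]
        rw [hfst, hrv]
        exact (f ⟨d, hd⟩).snd_ne_fst
      lst_le := fun d hd => by simp only [hd, dif_pos]; exact hc₂ _
      fst_eq_iff := fun d hd d' hd' => by
        simp only [hd, hd', dif_pos]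
        rw [hfst]
        have := hc ⟨d, hd⟩ ⟨d', hd'⟩
        simp only at this
        rw [this.1, this.2]
        exact ⟨fun h => by simp [h], fun h => hρ (le_antisymm h.2 h.1)⟩
      rev_lt_rev := fun d d' hlt hd' h => by
        have hd : d < N := by omega
        simp only [hd, hd', dif_pos] at h ⊢
        rw [hfst] at h
        rw [Fin.val_fin_lt, hf, hrv, hrv]
        rcases (hf ⟨d, hd⟩ ⟨d', hd'⟩).1 hlt with h' | h'
        · rw [h] at h'
          exact absurd h' (lt_irrefl _)
        · exact .inl h'.2 }
  refine ⟨X, rfl, fun x₁ x₂ a b ha hb hka hkb => ?_⟩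
  rw [DartList.wedges, DartList.pairCount_eq_card]
  -- Membership in `[a, b)` tests the attribute of the source only. Testing the reversal too, as
  -- `inner` does, brings in the target.
  have hmem : ∀ d (hd : d < N), d ∈ Finset.Ico a b ↔
      x₁ ≤ A (f ⟨d, hd⟩).fst ∧ A (f ⟨d, hd⟩).fst ≤ x₂ := by
    intro d hd
    have h1 := hka d hd
    have h2 := hkb d hd
    simp only [X, hd, dif_pos] at h1 h2
    rw [Finset.mem_Ico, ← h2, ← not_lt, h1, not_lt]
  have hinner : ∀ d, d ∈ X.inner (Finset.Ico a b) ↔ ∃ hd : d < N,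
      (x₁ ≤ A (f ⟨d, hd⟩).fst ∧ A (f ⟨d, hd⟩).fst ≤ x₂) ∧
      (x₁ ≤ A (f ⟨d, hd⟩).snd ∧ A (f ⟨d, hd⟩).snd ≤ x₂) := by
    intro d
    rw [DartList.inner, Finset.mem_filter]
    by_cases hd : d < N
    · have h1 : X.rev d = rv ⟨d, hd⟩ := by simp [X, hd]
      have h2 := hmem (rv ⟨d, hd⟩) (rv ⟨d, hd⟩).2
      rw [Fin.eta, hrv] at h2
      rw [h1, h2, hmem d hd]
      simp [hd, SimpleGraph.Dart.symm]
    · simp only [hd, IsEmpty.exists_iff, iff_false, not_and, Finset.mem_Ico]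
      intro h
      exact absurd (h.2.trans_le hb) hd
  have hXfst : ∀ i j (hi : i < N) (hj : j < N), X.fst i = X.fst j ↔
      (f ⟨i, hi⟩).fst = (f ⟨j, hj⟩).fst := by
    intro i j hi hj
    simp only [X, hi, hj, dif_pos]
    exact hfst _ _
  rw [rangeSubgraphCount_wedge G A x₁ x₂ ρ hρ]
  have hlt : ∀ z : {z : ℕ × ℕ // z.1 ∈ X.inner (Finset.Ico a b) ∧ z.2 ∈ X.inner (Finset.Ico a b) ∧
      z.1 < z.2 ∧ X.fst z.1 = X.fst z.2}, z.1.1 < N ∧ z.1.2 < N := fun z =>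
    ⟨((hinner _).1 z.2.1).1, ((hinner _).1 z.2.2.1).1⟩
  -- A pair of darts with a common source goes to that source and the two targets. Within a group,
  -- the order of the darts is the order of the ranks of their targets.
  refine Nat.card_eq_of_bijective (fun z =>
    ⟨(⟨(f ⟨z.1.1, (hlt z).1⟩).fst, ((hinner _).1 z.2.1).2.1⟩,
      ⟨(f ⟨z.1.1, (hlt z).1⟩).snd, ((hinner _).1 z.2.1).2.2⟩,
      ⟨(f ⟨z.1.2, (hlt z).2⟩).snd, ((hinner _).1 z.2.2.1).2.2⟩), ?_, ?_, ?_⟩) ⟨?_, ?_⟩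
  · exact (f ⟨z.1.1, (hlt z).1⟩).adj
  · have h := (hXfst _ _ (hlt z).1 (hlt z).2).1 z.2.2.2.2
    change G.Adj (f ⟨z.1.1, (hlt z).1⟩).fst (f ⟨z.1.2, (hlt z).2⟩).snd
    rw [h]
    exact (f ⟨z.1.2, (hlt z).2⟩).adj
  · have h := (hXfst _ _ (hlt z).1 (hlt z).2).1 z.2.2.2.2
    rcases (hf ⟨z.1.1, (hlt z).1⟩ ⟨z.1.2, (hlt z).2⟩).1 z.2.2.2.1 with h' | h'
    · rw [h] at h'
      exact absurd h' (lt_irrefl _)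
    · exact h'.2
  · rintro z z' h
    have e1 := (hXfst _ _ (hlt z).1 (hlt z).2).1 z.2.2.2.2
    have e2 := (hXfst _ _ (hlt z').1 (hlt z').2).1 z'.2.2.2.2
    simp only [Subtype.mk.injEq, Prod.mk.injEq] at h
    obtain ⟨h1, h2, h3⟩ := h
    have g1 := f.injective (SimpleGraph.Dart.ext _ _ (Prod.ext h1 h2))
    have g2 := f.injective (SimpleGraph.Dart.ext _ _ (Prod.ext ((e1.symm.trans h1).trans e2) h3))
    exact Subtype.ext (Prod.ext (congrArg Fin.val g1) (congrArg Fin.val g2))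
  · rintro ⟨⟨v, x, y⟩, h1, h2, h3⟩
    have h1' : G.Adj v x := h1
    have h2' : G.Adj v y := h2
    let i := f.symm ⟨(v.1, x.1), h1'⟩
    let j := f.symm ⟨(v.1, y.1), h2'⟩
    have hi : f i = ⟨(v.1, x.1), h1'⟩ := by simp [i]
    have hj : f j = ⟨(v.1, y.1), h2'⟩ := by simp [j]
    refine ⟨⟨(i, j), (hinner _).2 ⟨i.2, ?_⟩, (hinner _).2 ⟨j.2, ?_⟩, ?_,
      (hXfst _ _ i.2 j.2).2 ?_⟩, ?_⟩
    · simp only [Fin.eta, hi]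
      exact ⟨v.2, x.2⟩
    · simp only [Fin.eta, hj]
      exact ⟨v.2, y.2⟩
    · refine (hf i j).2 (.inr ?_)
      rw [hi, hj]
      exact ⟨rfl, h3⟩
    · simp only [Fin.eta, hi, hj]
    · simp only [Fin.eta, hi, hj]

/-! ### Rules for time-bounded execution, and binary search on the machine. -/

namespace WordRAM

/-- `Runs w p s T Q`: the program `p` started in `s` halts within `T` steps in a state satisfying
`Q`. -/
def Runs (w : ℕ) (p : Prog) (s : State) (T : ℕ) (Q : State → Prop) : Prop :=
  ∃ s' t, Exec w p s s' t ∧ t ≤ T ∧ Q s'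

section Rules

variable {w : ℕ} {p q : Prog} {s : State} {T T₁ T₂ : ℕ} {Q R : State → Prop} {e e₁ e₂ : Expr}
  {a b i : ℕ}

lemma Runs.mono (h : Runs w p s T₁ R) (hT : T₁ ≤ T₂) (hQ : ∀ s', R s' → Q s') : Runs w p s T₂ Q := by
  obtain ⟨s', t, h1, h2, h3⟩ := h
  exact ⟨s', t, h1, h2.trans hT, hQ _ h3⟩

lemma Runs.seq (h : Runs w p s T₁ R) (h' : ∀ s', R s' → Runs w q s' T₂ Q) :
    Runs w (.seq p q) s (T₁ + T₂) Q := by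
  obtain ⟨s₁, t₁, h1, h2, h3⟩ := h
  obtain ⟨s₂, t₂, h4, h5, h6⟩ := h' s₁ h3
  exact ⟨s₂, _, .seq _ _ _ _ _ _ _ h1 h4, by omega, h6⟩

lemma Runs.assign (he : e.eval w s = a) (h : Q { s with reg := Function.update s.reg i a }) :
    Runs w (.assign i e) s (e.cost + 1) Q :=
  ⟨_, _, .assign i e s, le_rfl, by rwa [he]⟩

lemma Runs.load (he : e.eval w s = a) (hm : s.mem[a]? = some b)
    (h : Q { s with reg := Function.update s.reg i b }) :
    Runs w (.load i e) s (e.cost + 1) Q :=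
  ⟨_, _, .load i e s b (by rwa [he]), le_rfl, h⟩

lemma Runs.rload {x : ℝ} (he : e.eval w s = a) (hm : s.rmem[a]? = some x)
    (h : Q { s with rreg := Function.update s.rreg i x }) :
    Runs w (.rload i e) s (e.cost + 1) Q :=
  ⟨_, _, .rload i e s x (by rwa [he]), le_rfl, h⟩

lemma Runs.skip (h : Q s) : Runs w .skip s 1 Q := ⟨_, _, .skip s, le_rfl, h⟩

lemma Runs.ite (hp : e.eval w s ≠ 0 → Runs w p s T Q) (hq : e.eval w s = 0 → Runs w q s T Q) :
    Runs w (.ite e p q) s (e.cost + 1 + T) Q := by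
  by_cases he : e.eval w s = 0
  · obtain ⟨s', t, h1, h2, h3⟩ := hq he
    exact ⟨s', _, .ite_false _ _ _ _ _ _ he h1, by omega, h3⟩
  · obtain ⟨s', t, h1, h2, h3⟩ := hp he
    exact ⟨s', _, .ite_true _ _ _ _ _ _ he h1, by omega, h3⟩

lemma Runs.loop_done (he : e.eval w s = 0) (h : Q s) : Runs w (.loop e p) s (e.cost + 1) Q :=
  ⟨_, _, .loop_done e p s he, le_rfl, h⟩

lemma Runs.loop_step (he : e.eval w s ≠ 0) (h : Runs w p s T₁ R)
    (h' : ∀ s', R s' → Runs w (.loop e p) s' T₂ Q) :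
    Runs w (.loop e p) s (e.cost + 1 + T₁ + T₂) Q := by
  obtain ⟨s₁, t₁, h1, h2, h3⟩ := h
  obtain ⟨s₂, t₂, h4, h5, h6⟩ := h' s₁ h3
  exact ⟨s₂, _, .loop_step _ _ _ _ _ _ _ he h1 h4, by omega, h6⟩

lemma eval_lit (h : a < 2 ^ w) : (Expr.lit a).eval w s = a := Nat.mod_eq_of_lt h

lemma eval_reg (h : s.reg i = a) : (Expr.reg i).eval w s = a := h

lemma eval_add (h₁ : e₁.eval w s = a) (h₂ : e₂.eval w s = b) (h : a + b < 2 ^ w) :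
    (Expr.op .add e₁ e₂).eval w s = a + b := by
  simp only [Expr.eval, h₁, h₂, BinOp.eval]
  exact Nat.mod_eq_of_lt h

lemma eval_mul (h₁ : e₁.eval w s = a) (h₂ : e₂.eval w s = b) (h : a * b < 2 ^ w) :
    (Expr.op .mul e₁ e₂).eval w s = a * b := by
  simp only [Expr.eval, h₁, h₂, BinOp.eval]
  exact Nat.mod_eq_of_lt h

lemma eval_sub (h₁ : e₁.eval w s = a) (h₂ : e₂.eval w s = b) (h : a < 2 ^ w) :
    (Expr.op .sub e₁ e₂).eval w s = a - b := by
  simp only [Expr.eval, h₁, h₂, BinOp.eval]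
  exact Nat.mod_eq_of_lt (by omega)

lemma eval_div (h₁ : e₁.eval w s = a) (h₂ : e₂.eval w s = b) (h : a < 2 ^ w) :
    (Expr.op .div e₁ e₂).eval w s = a / b := by
  simp only [Expr.eval, h₁, h₂, BinOp.eval]
  exact Nat.mod_eq_of_lt ((Nat.div_le_self _ _).trans_lt h)

lemma eval_lt (h₁ : e₁.eval w s = a) (h₂ : e₂.eval w s = b) (h : 1 < 2 ^ w) :
    (Expr.op .lt e₁ e₂).eval w s = if a < b then 1 else 0 := by
  simp only [Expr.eval, h₁, h₂, BinOp.eval]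
  exact Nat.mod_eq_of_lt (by split_ifs <;> omega)

lemma eval_eq (h₁ : e₁.eval w s = a) (h₂ : e₂.eval w s = b) (h : 1 < 2 ^ w) :
    (Expr.op .eq e₁ e₂).eval w s = if a = b then 1 else 0 := by
  simp only [Expr.eval, h₁, h₂, BinOp.eval]
  exact Nat.mod_eq_of_lt (by split_ifs <;> omega)

open Classical in
lemma eval_rle {j : ℕ} (h : 1 < 2 ^ w) :
    (Expr.rle i j).eval w s = if s.rreg i ≤ s.rreg j then 1 else 0 := by
  simp only [Expr.eval]
  exact Nat.mod_eq_of_lt (by split_ifs <;> omega)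

end Rules

/-- Two states that agree except for the word registers in `R` and the real registers from `2` on. -/
structure AgreeOff (R : List ℕ) (s s' : State) : Prop where
  mem : s'.mem = s.mem
  rmem : s'.rmem = s.rmem
  rreg_zero : s'.rreg 0 = s.rreg 0
  rreg_one : s'.rreg 1 = s.rreg 1
  reg : ∀ i, i ∉ R → s'.reg i = s.reg i

lemma AgreeOff.refl (R : List ℕ) (s : State) : AgreeOff R s s :=
  ⟨rfl, rfl, rfl, rfl, fun _ _ => rfl⟩

lemma AgreeOff.trans {R R' S : List ℕ} {s s' s'' : State} (h : AgreeOff R s s')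
    (h' : AgreeOff R' s' s'') (hR : R ⊆ S := by simp) (hR' : R' ⊆ S := by simp) :
    AgreeOff S s s'' :=
  ⟨h'.mem.trans h.mem, h'.rmem.trans h.rmem, h'.rreg_zero.trans h.rreg_zero,
    h'.rreg_one.trans h.rreg_one,
    fun i hi => (h'.reg i fun hh => hi (hR' hh)).trans (h.reg i fun hh => hi (hR hh))⟩

lemma AgreeOff.update {R S : List ℕ} {s s' : State} (h : AgreeOff R s s') (i a : ℕ)
    (hR : R ⊆ S := by simp) (hi : i ∈ S := by simp) :
    AgreeOff S s { s' with reg := Function.update s'.reg i a } :=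
  ⟨h.mem, h.rmem, h.rreg_zero, h.rreg_one, fun j hj => by
    have : j ≠ i := by rintro rfl; exact hj hi
    simp only [Function.update_of_ne this]
    exact h.reg j fun hh => hj (hR hh)⟩

/-- Binary search between the registers `8` and `9`. The probe position is put into register `10`,
`ld` fetches the data found there, and the search goes on to the right if the value of `e` is
nonzero. -/
def search (ld : Prog) (e : Expr) : Prog :=
  .loop (.op .lt (.reg 8) (.reg 9))
    (.seq (.assign 10 (.op .div (.op .add (.reg 8) (.reg 9)) (.lit 2)))
      (.seq ld (.ite e (.assign 8 (.op .add (.reg 10) (.lit 1))) (.assign 9 (.reg 10)))))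

/-- The invariant is that `P` holds on `[lo₀, lo)` and fails on `[hi, hi₀)`. The state `s₀` is the
one before the search, which lets the hypothesis on `ld` refer to data untouched by the scratch
registers. `n` bounds the number of halvings, and `hw` keeps `lo + hi` from wrapping around. -/
lemma runs_search {w : ℕ} {ld : Prog} {e : Expr} {P : ℕ → Prop} {s₀ : State} {lo₀ hi₀ Tl : ℕ}
    (hw : 2 * hi₀ + 2 < 2 ^ w)
    (hld : ∀ s v, AgreeOff [8, 9, 10, 11] s₀ s → lo₀ ≤ v → v < hi₀ → s.reg 10 = v →
      Runs w ld s Tl fun s' => AgreeOff [11] s s' ∧ (e.eval w s' ≠ 0 ↔ P v))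
    (hP : ∀ u v, lo₀ ≤ u → u ≤ v → v < hi₀ → P v → P u) (n : ℕ) :
    ∀ s lo hi, AgreeOff [8, 9, 10, 11] s₀ s → s.reg 8 = lo → s.reg 9 = hi → lo₀ ≤ lo → lo ≤ hi →
      hi ≤ hi₀ → (∀ v, lo₀ ≤ v → v < lo → P v) → (∀ v, hi ≤ v → v < hi₀ → ¬ P v) → hi - lo < 2 ^ n →
      Runs w (search ld e) s ((n + 1) * (Tl + e.cost + 16)) fun s' =>
        AgreeOff [8, 9, 10, 11] s₀ s' ∧ ∃ l, s'.reg 8 = l ∧ lo₀ ≤ l ∧ l ≤ hi₀ ∧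
          (∀ v, lo₀ ≤ v → v < l → P v) ∧ (∀ v, l ≤ v → v < hi₀ → ¬ P v) := by
  -- The exit at `lo = hi` is stated for every `n`, since the interval can become empty before the
  -- budget of halvings is spent.
  have hdone : ∀ (n : ℕ) s lo hi, AgreeOff [8, 9, 10, 11] s₀ s → s.reg 8 = lo → s.reg 9 = hi →
      lo₀ ≤ lo → lo = hi →
      hi ≤ hi₀ → (∀ v, lo₀ ≤ v → v < lo → P v) → (∀ v, hi ≤ v → v < hi₀ → ¬ P v) →
      Runs w (search ld e) s ((n + 1) * (Tl + e.cost + 16)) fun s' =>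
        AgreeOff [8, 9, 10, 11] s₀ s' ∧ ∃ l, s'.reg 8 = l ∧ lo₀ ≤ l ∧ l ≤ hi₀ ∧
          (∀ v, lo₀ ≤ v → v < l → P v) ∧ (∀ v, l ≤ v → v < hi₀ → ¬ P v) := by
    rintro n s lo hi hs h8 h9 h1 rfl h2 h3 h4
    refine Runs.mono (Runs.loop_done (Q := fun s' => s' = s) ?_ rfl) ?_ ?_
    · rw [eval_lt (eval_reg h8) (eval_reg h9) (by omega)]
      simp
    · simp only [Expr.cost]
      nlinarith
    · rintro _ rfl
      exact ⟨hs, lo, h8, h1, h2, h3, h4⟩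
  induction n with
  | zero =>
    intro s lo hi hs h8 h9 h1 h2 h3 h4 h5 h6
    exact hdone 0 s lo hi hs h8 h9 h1 (by omega) h3 h4 h5
  | succ n ih =>
    intro s lo hi hs h8 h9 h1 h2 h3 h4 h5 h6
    rcases h2.eq_or_lt with h2 | h2
    · exact hdone _ s lo hi hs h8 h9 h1 h2 h3 h4 h5
    rw [pow_succ] at h6
    have hbody : Runs w (.seq (.assign 10 (.op .div (.op .add (.reg 8) (.reg 9)) (.lit 2)))
      (.seq ld (.ite e (.assign 8 (.op .add (.reg 10) (.lit 1))) (.assign 9 (.reg 10))))) s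
      (6 + (Tl + (e.cost + 1 + 4))) fun s' => AgreeOff [8, 9, 10, 11] s₀ s' ∧
        ∃ lo' hi', s'.reg 8 = lo' ∧ s'.reg 9 = hi' ∧ lo₀ ≤ lo' ∧ lo' ≤ hi' ∧ hi' ≤ hi₀ ∧
          (∀ v, lo₀ ≤ v → v < lo' → P v) ∧ (∀ v, hi' ≤ v → v < hi₀ → ¬ P v) ∧
          hi' - lo' < 2 ^ n := by
      refine Runs.seq (Runs.assign (a := (lo + hi) / 2) (eval_div (eval_add (eval_reg h8)
        (eval_reg h9) (by omega)) (eval_lit (by omega)) (by omega)) rfl) ?_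
      rintro s₁ rfl
      have hs₁ : AgreeOff [8, 9, 10, 11] s₀ { s with reg := Function.update s.reg 10 ((lo + hi) / 2) } :=
        hs.update 10 _
      refine Runs.seq (hld _ ((lo + hi) / 2) hs₁ (by omega) (by omega) (by simp)) ?_
      rintro s₂ ⟨hs₂, he⟩
      have hs' : AgreeOff [8, 9, 10, 11] s₀ s₂ := hs₁.trans hs₂
      have e8 : s₂.reg 8 = lo := by rw [hs₂.reg 8 (by simp)]; simpa using h8
      have e9 : s₂.reg 9 = hi := by rw [hs₂.reg 9 (by simp)]; simpa using h9
      have e10 : s₂.reg 10 = (lo + hi) / 2 := by rw [hs₂.reg 10 (by simp)]; simp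
      refine Runs.ite (fun h => ?_) (fun h => ?_)
      · have hPm := he.1 h
        refine Runs.assign (a := (lo + hi) / 2 + 1)
          (eval_add (eval_reg e10) (eval_lit (by omega)) (by omega)) ⟨hs'.update 8 _, ?_⟩
        refine ⟨(lo + hi) / 2 + 1, hi, by simp, by simpa using e9, by omega, by omega, h3,
          fun v hv hv' => ?_, h5, by omega⟩
        exact hP v _ hv (Nat.le_of_lt_succ hv') (by omega) hPm
      · have hPm := fun hh => he.2 hh h
        refine Runs.mono (Runs.assign (a := (lo + hi) / 2)
          (eval_reg e10) (Q := fun s' => s' = _) rfl) (by simp [Expr.cost]) ?_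
        rintro _ rfl
        refine ⟨hs'.update 9 _, lo, (lo + hi) / 2, by simpa using e8, by simp, h1, by omega,
          by omega, h4, fun v hv hv' hPv => ?_, by omega⟩
        exact hPm (hP _ v (by omega) hv hv' hPv)
    refine Runs.mono (Runs.loop_step (T₂ := (n + 1) * (Tl + e.cost + 16)) ?_ hbody
      fun s' hs' => ?_) ?_ fun _ h => h
    · rw [eval_lt (eval_reg h8) (eval_reg h9) (by omega)]
      simp [h2]
    · obtain ⟨g1, lo', hi', g2, g3, g4, g5, g6, g7, g8, g9⟩ := hs'
      exact ih s' lo' hi' g1 g2 g3 g4 g5 g6 g7 g8 g9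
    · simp only [Expr.cost]
      linarith [add_mul (n + 1) 1 (Tl + e.cost + 16)]

end WordRAM

/-! ### Memory layout, degrees and extension of the range. -/

namespace WordRAM

/-- The contents of the memory: `N`, the block length `B` and the number `K` of block boundaries, then
the reversals and group limits of the darts, and the table of the answers for all pairs of block
boundaries; the real memory holds the keys. -/
structure Stored (X : DartList) (B K : ℕ) (mem : List ℕ) (rmem : List ℝ) : Prop where
  size : mem[0]? = some X.N
  block : mem[1]? = some B
  width : mem[2]? = some K
  rev : ∀ d < X.N, mem[3 + d]? = some (X.rev d)
  fst : ∀ d < X.N, mem[3 + X.N + d]? = some (X.fst d)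
  lst : ∀ d < X.N, mem[3 + 2 * X.N + d]? = some (X.lst d)
  table : ∀ i < K, ∀ j < K, mem[3 + 3 * X.N + (i * K + j)]? = some (X.wedges (i * B) (j * B))
  key : ∀ d < X.N, rmem[d]? = some (X.key d)

/-- The memory holds the data structure, and the registers `1`, `2`, `3` its parameters. -/
structure Ready (X : DartList) (B K : ℕ) (s : State) : Prop where
  stored : Stored X B K s.mem s.rmem
  reg_one : s.reg 1 = X.N
  reg_two : s.reg 2 = B
  reg_three : s.reg 3 = K

lemma Ready.of_agreeOff {X : DartList} {B K : ℕ} {R : List ℕ} {s s' : State} (h : Ready X B K s)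
    (hs : AgreeOff R s s') (h1 : 1 ∉ R := by simp) (h2 : 2 ∉ R := by simp)
    (h3 : 3 ∉ R := by simp) : Ready X B K s' :=
  ⟨by rw [hs.mem, hs.rmem]; exact h.stored, (hs.reg 1 h1).trans h.reg_one,
    (hs.reg 2 h2).trans h.reg_two, (hs.reg 3 h3).trans h.reg_three⟩

/-- Binary search among the darts with the same source as the dart in register `13`; during the search
the register `11` contains the reversal of the probe. -/
def groupSearch (e : Expr) : Prog :=
  .seq (.load 8 (.op .add (.op .add (.lit 3) (.reg 1)) (.reg 13)))
    (.seq (.load 9 (.op .add (.op .add (.lit 3) (.op .mul (.lit 2) (.reg 1))) (.reg 13)))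
      (search (.load 11 (.op .add (.lit 3) (.reg 10))) e))

/-- Add to register `0` the number of darts with the same source as the dart in register `13` that
lie, together with their reversals, between the registers `4` and `5`. -/
def addDegree : Prog :=
  .seq (groupSearch (.op .add (.op .lt (.reg 11) (.reg 4)) (.op .lt (.reg 10) (.reg 4))))
    (.seq (.assign 15 (.reg 8))
      (.seq (groupSearch (.op .mul (.op .lt (.reg 11) (.reg 5)) (.op .lt (.reg 10) (.reg 5))))
        (.assign 0 (.op .add (.reg 0) (.op .sub (.reg 8) (.reg 15))))))

/-- Add to register `0` the number of wedges gained when the dart in register `16` is added to those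
between the registers `4` and `5`. -/
def addGain : Prog :=
  .seq (.load 14 (.op .add (.lit 3) (.reg 16)))
    (.ite (.op .mul (.op .eq (.op .lt (.reg 14) (.reg 4)) (.lit 0)) (.op .lt (.reg 14) (.reg 5)))
      (.seq (.assign 13 (.reg 16)) (.seq addDegree (.seq (.assign 13 (.reg 14)) addDegree)))
      .skip)

/-- Extend the range to the left as far as register `6`. -/
def extendLeft : Prog :=
  .loop (.op .lt (.reg 6) (.reg 4))
    (.seq (.assign 16 (.op .sub (.reg 4) (.lit 1))) (.seq addGain (.assign 4 (.reg 16))))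

/-- Extend the range to the right as far as register `7`. -/
def extendRight : Prog :=
  .loop (.op .lt (.reg 5) (.reg 7))
    (.seq (.assign 16 (.reg 5)) (.seq addGain (.assign 5 (.op .add (.reg 5) (.lit 1)))))

section

variable {w n : ℕ} {X : DartList} {B K : ℕ} {s : State}

lemma runs_groupSearch (hw : 10 * X.N + 10 < 2 ^ w) (hn : X.N < 2 ^ n) (hs : Ready X B K s)
    {d : ℕ} (hd : d < X.N) (h13 : s.reg 13 = d) {e : Expr} {P : ℕ → Prop}
    (he : ∀ s' v, AgreeOff [8, 9, 10, 11] s s' → s'.reg 10 = v → s'.reg 11 = X.rev v →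
      (e.eval w s' ≠ 0 ↔ P v))
    (hP : ∀ u v, X.fst d ≤ u → u ≤ v → v < X.lst d → P v → P u) :
    Runs w (groupSearch e) s ((n + 1) * (e.cost + 40)) fun s' => AgreeOff [8, 9, 10, 11] s s' ∧
      ∃ l, s'.reg 8 = l ∧ X.fst d ≤ l ∧ l ≤ X.lst d ∧
          (∀ v, X.fst d ≤ v → v < l → P v) ∧ (∀ v, l ≤ v → v < X.lst d → ¬ P v) := by
  have hlst := X.lst_le d hd
  have hfl := X.fst_le hd
  have hll := X.lt_lst hd
  refine Runs.mono (Runs.seq (Runs.load (eval_add (eval_add (eval_lit (by omega))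
    (eval_reg hs.reg_one) (by omega)) (eval_reg h13) (by omega)) (hs.stored.fst d hd)
    (Q := fun s' => s' = _) rfl) ?_ (T₂ := 8 + (n + 1) * (4 + e.cost + 16))) ?_ fun _ h => h
  · rintro _ rfl
    have hs₁ : AgreeOff [8] s { s with reg := Function.update s.reg 8 (X.fst d) } :=
      (AgreeOff.refl [] s).update 8 _
    refine Runs.seq (Runs.load (eval_add (eval_add (eval_lit (by omega))
      (eval_mul (eval_lit (by omega)) (eval_reg (hs.of_agreeOff hs₁).reg_one) (by omega)) (by omega))
      (eval_reg ((hs₁.reg 13 (by simp)).trans h13)) (by omega)) (hs.stored.lst d hd)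
      (Q := fun s' => s' = _) rfl) ?_
    rintro _ rfl
    refine runs_search (P := P) (Tl := 4) (lo₀ := X.fst d) (hi₀ := X.lst d) (by omega) ?_ hP n _
      (X.fst d) (X.lst d) (hs₁.update 9 _) (by simp) (by simp) le_rfl (by omega) le_rfl
      (fun v _ _ => by omega) (fun v _ _ => by omega) (by omega)
    intro s₂ v hs₂ hv hv' h10
    have hr₂ := hs.of_agreeOff hs₂
    refine Runs.load (eval_add (eval_lit (by omega)) (eval_reg h10) (by omega))
      (hr₂.stored.rev v (by omega)) ⟨(AgreeOff.refl [] s₂).update 11 _, ?_⟩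
    exact he _ v (hs₂.update 11 _) (by simpa using h10) (by simp)
  · simp only [Expr.cost]
    nlinarith

/-- The two searches compute `l` and `l'` of `deg_eq_sub`; register `15` keeps `l` during the second
one. -/
lemma runs_addDegree (hw : 10 * X.N + 10 < 2 ^ w) (hn : X.N < 2 ^ n) (hs : Ready X B K s)
    {d p q z : ℕ} (hd : d < X.N) (h13 : s.reg 13 = d) (h4 : s.reg 4 = p) (h5 : s.reg 5 = q)
    (hq : q ≤ X.N) (h0 : s.reg 0 = z)
    (hz : z + X.deg (X.inner (Finset.Ico p q)) d < 2 ^ w) :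
    Runs w addDegree s ((n + 1) * 110) fun s' => AgreeOff [0, 8, 9, 10, 11, 15] s s' ∧
      s'.reg 0 = z + X.deg (X.inner (Finset.Ico p q)) d := by
  have hlst := X.lst_le d hd
  refine Runs.mono (Runs.seq (runs_groupSearch hw hn hs hd h13
    (P := fun v => v < p ∨ X.rev v < p) ?_ ?_) ?_
    (T₂ := 2 + ((n + 1) * (7 + 40) + 6))) ?_ fun _ h => h
  · intro s' v hs' h10 h11
    have h4' := (hs'.reg 4 (by simp)).trans h4
    -- On the values `0` and `1`, a sum is nonzero exactly for a disjunction; below, a product plays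
    -- the role of a conjunction.
    rw [eval_add (eval_lt (eval_reg h11) (eval_reg h4') (by omega))
      (eval_lt (eval_reg h10) (eval_reg h4') (by omega)) (by split_ifs <;> omega)]
    split_ifs <;> simp <;> omega
  · intro u v hu huv hv h
    have := X.rev_mono_group hd hu huv hv
    omega
  · rintro s₁ ⟨hs₁, l, g1, g2, g3, g4, g5⟩
    refine Runs.seq (Runs.assign (eval_reg g1) (Q := fun s' => s' = _) rfl) ?_
    rintro _ rfl
    have hs₂ : AgreeOff [8, 9, 10, 11, 15] s
      { s₁ with reg := Function.update s₁.reg 15 l } := hs₁.update 15 l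
    refine Runs.seq (runs_groupSearch hw hn (hs.of_agreeOff hs₂) hd
      ((hs₂.reg 13 (by simp)).trans h13) (P := fun v => v < q ∧ X.rev v < q) ?_ ?_) ?_
    · intro s' v hs' h10 h11
      have h5' := ((hs₂.trans hs' (S := [8, 9, 10, 11, 15])).reg 5 (by simp)).trans h5
      rw [eval_mul (eval_lt (eval_reg h11) (eval_reg h5') (by omega))
        (eval_lt (eval_reg h10) (eval_reg h5') (by omega)) (by split_ifs <;> omega)]
      split_ifs <;> simp <;> omega
    · intro u v hu huv hv h
      have := X.rev_mono_group hd hu huv hv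
      omega
    · rintro s₃ ⟨hs₃, l', g1', g2', g3', g4', g5'⟩
      have hdeg := X.deg_eq_sub hq hd g2 g3' g4 (fun v hv hv' => by have := g5 v hv hv'; omega) g4'
        (fun v hv hv' => by have := g5' v hv hv'; omega)
      have hs₄ : AgreeOff [8, 9, 10, 11, 15] s s₃ := hs₂.trans hs₃
      rw [hdeg] at hz ⊢
      refine Runs.assign (eval_add (eval_reg ((hs₄.reg 0 (by simp)).trans h0))
        (eval_sub (eval_reg g1') (eval_reg (a := l) ?_) (by omega)) hz) ⟨hs₄.update 0 _, by simp⟩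
      rw [hs₃.reg 15 (by simp)]
      simp
  · simp only [Expr.cost]
    omega

lemma runs_addGain (hw : 10 * X.N + 10 < 2 ^ w) (hn : X.N < 2 ^ n) (hs : Ready X B K s)
    {d p q z : ℕ} (hd : d < X.N) (h16 : s.reg 16 = d) (h4 : s.reg 4 = p) (h5 : s.reg 5 = q)
    (hq : q ≤ X.N) (h0 : s.reg 0 = z) (hz : z + X.gain p q d < 2 ^ w) :
    Runs w addGain s ((n + 1) * 250) fun s' => AgreeOff [0, 8, 9, 10, 11, 13, 14, 15] s s' ∧
      s'.reg 0 = z + X.gain p q d := by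
  refine Runs.mono (Runs.seq (Runs.load (eval_add (eval_lit (by omega)) (eval_reg h16) (by omega))
    (hs.stored.rev d hd) (Q := fun s' => s' = _) rfl) ?_
    (T₂ := 10 + (2 + ((n + 1) * 110 + (2 + (n + 1) * 110))))) ?_ fun _ h => h
  · rintro _ rfl
    have hs₁ : AgreeOff [14] s { s with reg := Function.update s.reg 14 (X.rev d) } :=
      (AgreeOff.refl [] s).update 14 _
    have h14 : (Expr.reg 14).eval w { s with reg := Function.update s.reg 14 (X.rev d) } = X.rev d :=
      eval_reg (by simp)
    have hcond : (Expr.op .mul (.op .eq (.op .lt (.reg 14) (.reg 4)) (.lit 0))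
        (.op .lt (.reg 14) (.reg 5))).eval w { s with reg := Function.update s.reg 14 (X.rev d) } =
        if p ≤ X.rev d ∧ X.rev d < q then 1 else 0 := by
      rw [eval_mul (eval_eq (eval_lt h14 (eval_reg ((hs₁.reg 4 (by simp)).trans h4)) (by omega))
        (eval_lit (by omega)) (by omega))
        (eval_lt h14 (eval_reg ((hs₁.reg 5 (by simp)).trans h5)) (by omega))
        (by split_ifs <;> omega)]
      split_ifs <;> omega
    refine Runs.ite (fun h => ?_) (fun h => ?_)
    · rw [hcond] at h
      have h' : p ≤ X.rev d ∧ X.rev d < q := by simpa using h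
      rw [DartList.gain, if_pos h'] at hz ⊢
      refine Runs.seq (Runs.assign (eval_reg ((hs₁.reg 16 (by simp)).trans h16))
        (Q := fun s' => s' = _) rfl) ?_
      rintro _ rfl
      have hs₂ := hs₁.update 13 d (S := [13, 14])
      refine Runs.seq (runs_addDegree hw hn (hs.of_agreeOff hs₂) hd (by simp)
        ((hs₂.reg 4 (by simp)).trans h4) ((hs₂.reg 5 (by simp)).trans h5) hq
        ((hs₂.reg 0 (by simp)).trans h0) (by omega)) ?_
      rintro s₃ ⟨hs₃, g0⟩
      have hs₃' : AgreeOff [0, 8, 9, 10, 11, 13, 14, 15] s s₃ := hs₂.trans hs₃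
      have g14 : s₃.reg 14 = X.rev d := by
        rw [hs₃.reg 14 (by simp)]
        simp
      refine Runs.seq (Runs.assign (eval_reg g14) (Q := fun s' => s' = _) rfl) ?_
      rintro _ rfl
      have hs₄ := hs₃'.update 13 (X.rev d) (S := [0, 8, 9, 10, 11, 13, 14, 15])
      refine Runs.mono (runs_addDegree hw hn (hs.of_agreeOff hs₄) (X.rev_lt d hd) (by simp)
        ((hs₄.reg 4 (by simp)).trans h4) ((hs₄.reg 5 (by simp)).trans h5) hq
        (z := z + X.deg (X.inner (Finset.Ico p q)) d) (by simpa using g0) (by omega)) le_rfl ?_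
      rintro s₅ ⟨hs₅, g0'⟩
      exact ⟨hs₄.trans hs₅, by omega⟩
    · rw [hcond] at h
      have h' : ¬ (p ≤ X.rev d ∧ X.rev d < q) := by simpa using h
      rw [DartList.gain, if_neg h']
      refine Runs.mono (Runs.skip (Q := fun s' => s' = _) rfl) (by omega) ?_
      rintro _ rfl
      exact ⟨hs₁.trans (AgreeOff.refl [] _), by simpa using h0⟩
  · simp only [Expr.cost]
    omega

/-- The invariant is that register `0` holds the count of the current range, and `k` bounds the
remaining iterations. The final boundary is `min a p` because `a` may already exceed `p`, which
happens for an inverted query. -/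
lemma runs_extendLeft (hw : 10 * X.N + X.N * X.N + 10 < 2 ^ w) (hn : X.N < 2 ^ n) {a q : ℕ}
    (hq : q ≤ X.N) (k : ℕ) :
    ∀ s p, Ready X B K s → s.reg 4 = p → s.reg 5 = q → s.reg 6 = a → s.reg 0 = X.wedges p q →
      p ≤ q → p - a ≤ k →
      Runs w extendLeft s ((n + 1) * 270 * k + 10) fun s' =>
        AgreeOff [0, 4, 8, 9, 10, 11, 13, 14, 15, 16] s s' ∧ s'.reg 4 = min a p ∧
          s'.reg 0 = X.wedges (min a p) q := by
  induction k with
  | zero =>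
    intro s p hs h4 h5 h6 h0 hpq hk
    refine Runs.mono (Runs.loop_done (Q := fun s' => s' = s) ?_ rfl) (by simp [Expr.cost]) ?_
    · rw [eval_lt (eval_reg h6) (eval_reg h4) (by omega), if_neg (by omega)]
    · rintro _ rfl
      rw [min_eq_right (by omega)]
      exact ⟨.refl _ _, h4, h0⟩
  | succ k ih =>
    intro s p hs h4 h5 h6 h0 hpq hk
    by_cases hap : a < p
    · have hbody : Runs w (.seq (.assign 16 (.op .sub (.reg 4) (.lit 1)))
          (.seq addGain (.assign 4 (.reg 16)))) s (4 + ((n + 1) * 250 + 2)) fun s' =>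
          AgreeOff [0, 4, 8, 9, 10, 11, 13, 14, 15, 16] s s' ∧ s'.reg 4 = p - 1 ∧
            s'.reg 0 = X.wedges (p - 1) q := by
        have hX := X.wedges_pred hq (by omega) hpq
        -- The new count is at most `N²`, so adding the gain does not overflow.
        have hle := X.wedges_le (p := p - 1) hq
        refine Runs.seq (Runs.assign (eval_sub (eval_reg h4) (eval_lit (by omega)) (by omega))
          (Q := fun s' => s' = _) rfl) ?_
        rintro _ rfl
        have hs₁ := (AgreeOff.refl [] s).update 16 (p - 1) (S := [16])
        refine Runs.seq (runs_addGain (d := p - 1) (by omega) hn (hs.of_agreeOff hs₁) (by omega)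
          (by simp) ((hs₁.reg 4 (by simp)).trans h4) ((hs₁.reg 5 (by simp)).trans h5) hq
          ((hs₁.reg 0 (by simp)).trans h0) (by omega)) ?_
        rintro s₂ ⟨hs₂, g0⟩
        have g16 : s₂.reg 16 = p - 1 := by
          rw [hs₂.reg 16 (by simp)]
          simp
        exact Runs.assign (eval_reg g16) ⟨(hs₁.trans hs₂
          (S := [0, 4, 8, 9, 10, 11, 13, 14, 15, 16])).update 4 _, by simp, by simpa [hX] using g0⟩
      refine Runs.mono (Runs.loop_step ?_ hbody (T₂ := (n + 1) * 270 * k + 10)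
        (Q := fun s' => AgreeOff [0, 4, 8, 9, 10, 11, 13, 14, 15, 16] s s' ∧ s'.reg 4 = min a p ∧
          s'.reg 0 = X.wedges (min a p) q) ?_) ?_ fun _ h => h
      · rw [eval_lt (eval_reg h6) (eval_reg h4) (by omega), if_pos hap]
        simp
      · rintro s' ⟨g1, g2, g3⟩
        refine Runs.mono (ih s' (p - 1) (hs.of_agreeOff g1) g2 ((g1.reg 5 (by simp)).trans h5)
          ((g1.reg 6 (by simp)).trans h6) g3 (by omega) (by omega)) le_rfl ?_
        rintro s'' ⟨f1, f2, f3⟩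
        rw [min_eq_left (by omega)] at f2 f3 ⊢
        exact ⟨g1.trans f1, f2, f3⟩
      · simp only [Expr.cost]
        rw [mul_add _ k]
        omega
    · refine Runs.mono (Runs.loop_done (Q := fun s' => s' = s) ?_ rfl) (by simp [Expr.cost]) ?_
      · rw [eval_lt (eval_reg h6) (eval_reg h4) (by omega), if_neg hap]
      · rintro _ rfl
        rw [min_eq_right (by omega)]
        exact ⟨.refl _ _, h4, h0⟩

lemma runs_extendRight (hw : 10 * X.N + X.N * X.N + 10 < 2 ^ w) (hn : X.N < 2 ^ n) {b p : ℕ}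
    (hb : b ≤ X.N) (k : ℕ) :
    ∀ s q, Ready X B K s → s.reg 4 = p → s.reg 5 = q → s.reg 7 = b → s.reg 0 = X.wedges p q →
      p ≤ q → q ≤ X.N → b - q ≤ k →
      Runs w extendRight s ((n + 1) * 270 * k + 10) fun s' =>
        AgreeOff [0, 5, 8, 9, 10, 11, 13, 14, 15, 16] s s' ∧
          s'.reg 0 = X.wedges p (max b q) := by
  induction k with
  | zero =>
    intro s q hs h4 h5 h7 h0 hpq hq hk
    refine Runs.mono (Runs.loop_done (Q := fun s' => s' = s) ?_ rfl) (by simp [Expr.cost]) ?_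
    · rw [eval_lt (eval_reg h5) (eval_reg h7) (by omega), if_neg (by omega)]
    · rintro _ rfl
      rw [max_eq_right (by omega)]
      exact ⟨.refl _ _, h0⟩
  | succ k ih =>
    intro s q hs h4 h5 h7 h0 hpq hq hk
    by_cases hqb : q < b
    · have hbody : Runs w (.seq (.assign 16 (.reg 5)) (.seq addGain
          (.assign 5 (.op .add (.reg 5) (.lit 1))))) s (2 + ((n + 1) * 250 + 4)) fun s' =>
          AgreeOff [0, 5, 8, 9, 10, 11, 13, 14, 15, 16] s s' ∧ s'.reg 5 = q + 1 ∧
            s'.reg 0 = X.wedges p (q + 1) := by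
        have hX := X.wedges_succ (hqb.trans_le hb) hpq
        have hle := X.wedges_le (p := p) (q := q + 1) (by omega)
        refine Runs.seq (Runs.assign (eval_reg h5) (Q := fun s' => s' = _) rfl) ?_
        rintro _ rfl
        have hs₁ := (AgreeOff.refl [] s).update 16 q (S := [16])
        refine Runs.seq (runs_addGain (d := q) (by omega) hn (hs.of_agreeOff hs₁) (by omega)
          (by simp) ((hs₁.reg 4 (by simp)).trans h4) ((hs₁.reg 5 (by simp)).trans h5) hq
          ((hs₁.reg 0 (by simp)).trans h0) (by omega)) ?_
        rintro s₂ ⟨hs₂, g0⟩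
        have hs₃ : AgreeOff [0, 8, 9, 10, 11, 13, 14, 15, 16] s s₂ := hs₁.trans hs₂
        exact Runs.assign (eval_add (eval_reg ((hs₃.reg 5 (by simp)).trans h5))
          (eval_lit (by omega)) (by omega)) ⟨hs₃.update 5 _, by simp, by simpa [hX] using g0⟩
      refine Runs.mono (Runs.loop_step ?_ hbody (T₂ := (n + 1) * 270 * k + 10)
        (Q := fun s' => AgreeOff [0, 5, 8, 9, 10, 11, 13, 14, 15, 16] s s' ∧
          s'.reg 0 = X.wedges p (max b q)) ?_) ?_ fun _ h => h
      · rw [eval_lt (eval_reg h5) (eval_reg h7) (by omega), if_pos hqb]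
        simp
      · rintro s' ⟨g1, g2, g3⟩
        refine Runs.mono (ih s' (q + 1) (hs.of_agreeOff g1) ((g1.reg 4 (by simp)).trans h4) g2
          ((g1.reg 7 (by simp)).trans h7) g3 (by omega) (by omega) (by omega)) le_rfl ?_
        rintro s'' ⟨f1, f2⟩
        rw [max_eq_left (by omega)] at f2 ⊢
        exact ⟨g1.trans f1, f2⟩
      · simp only [Expr.cost]
        rw [mul_add _ k]
        omega
    · refine Runs.mono (Runs.loop_done (Q := fun s' => s' = s) ?_ rfl) (by simp [Expr.cost]) ?_
      · rw [eval_lt (eval_reg h5) (eval_reg h7) (by omega), if_neg hqb]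
      · rintro _ rfl
        rw [max_eq_right (by omega)]
        exact ⟨.refl _ _, h0⟩

end

end WordRAM

/-! ### Locating the endpoints, choosing the stored range, and the full query. -/

namespace WordRAM

/-- Binary search among the keys; during the search the real register `2` contains the key of the
probe. -/
def keySearch (e : Expr) : Prog :=
  .seq (.assign 8 (.lit 0)) (.seq (.assign 9 (.reg 1)) (search (.rload 2 (.reg 10)) e))

/-- Find the darts whose keys lie between the real registers `0` and `1`: those between the registers
`6` and `7`. -/
def locate : Prog :=
  .seq (keySearch (.op .eq (.rle 0 2) (.lit 0))) (.seq (.assign 6 (.reg 8))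
    (.seq (keySearch (.rle 2 1)) (.assign 7 (.reg 8))))

/-- Choose the largest range between block boundaries that lies between the registers `6` and `7`, and
look up its number of wedges. -/
def startRange : Prog :=
  .seq (.assign 14 (.op .div (.op .sub (.op .add (.reg 6) (.reg 2)) (.lit 1)) (.reg 2)))
    (.seq (.assign 16 (.op .div (.reg 7) (.reg 2)))
      (.ite (.op .lt (.reg 16) (.reg 14))
        (.seq (.assign 4 (.reg 7)) (.assign 5 (.reg 7)))
        (.seq (.assign 4 (.op .mul (.reg 14) (.reg 2)))
          (.seq (.assign 5 (.op .mul (.reg 16) (.reg 2)))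
            (.load 0 (.op .add (.op .add (.lit 3) (.op .mul (.lit 3) (.reg 1)))
              (.op .add (.op .mul (.reg 14) (.reg 3)) (.reg 16))))))))

/-- The query program. -/
def query : Prog :=
  .seq (.load 1 (.lit 0)) (.seq (.load 2 (.lit 1)) (.seq (.load 3 (.lit 2))
    (.seq locate (.seq startRange (.seq extendLeft extendRight)))))

section

variable {w n : ℕ} {X : DartList} {B K : ℕ} {s : State}

lemma runs_keySearch (hw : 10 * X.N + 10 < 2 ^ w) (hn : X.N < 2 ^ n) (hs : Ready X B K s)
    {e : Expr} {P : ℕ → Prop}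
    (he : ∀ s' v, AgreeOff [8, 9, 10, 11] s s' → s'.rreg 2 = X.key v → (e.eval w s' ≠ 0 ↔ P v))
    (hP : ∀ u v, u ≤ v → v < X.N → P v → P u) :
    Runs w (keySearch e) s ((n + 1) * (e.cost + 30)) fun s' => AgreeOff [8, 9, 10, 11] s s' ∧
      ∃ l, s'.reg 8 = l ∧ l ≤ X.N ∧ ∀ d < X.N, d < l ↔ P d := by
  refine Runs.mono (Runs.seq (Runs.assign (eval_lit (by omega)) (Q := fun s' => s' = _) rfl) ?_
    (T₂ := 2 + (n + 1) * (2 + e.cost + 16))) ?_ fun _ h => h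
  · rintro _ rfl
    have hs₁ := (AgreeOff.refl [] s).update 8 0 (S := [8])
    refine Runs.seq (Runs.assign (eval_reg (hs.of_agreeOff hs₁).reg_one)
      (Q := fun s' => s' = _) rfl) ?_
    rintro _ rfl
    refine Runs.mono (runs_search (P := P) (Tl := 2) (lo₀ := 0) (hi₀ := X.N) (by omega) ?_
      (fun u v _ => hP u v) n _ 0 X.N (hs₁.update 9 _) (by simp) (by simp) le_rfl (by omega) le_rfl
      (fun v _ _ => by omega) (fun v _ _ => by omega) (by omega)) le_rfl ?_
    · intro s₂ v hs₂ hv hv' h10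
      refine Runs.rload (eval_reg h10) ((hs.of_agreeOff hs₂).stored.key v hv') ⟨?_, ?_⟩
      · exact ⟨rfl, rfl, by simp, by simp, fun _ _ => rfl⟩
      · exact he _ v ⟨hs₂.mem, hs₂.rmem, by simpa using hs₂.rreg_zero, by simpa using hs₂.rreg_one,
          hs₂.reg⟩ (by simp)
    · rintro s' ⟨h1, l, h2, h3, h4, h5, h6⟩
      exact ⟨h1, l, h2, h4, fun d hd => ⟨h5 d (by omega), fun h => by
        by_contra! hl
        exact h6 d hl hd h⟩⟩
  · simp only [Expr.cost]
    nlinarith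

lemma runs_locate (hw : 10 * X.N + 10 < 2 ^ w) (hn : X.N < 2 ^ n) (hs : Ready X B K s) :
    Runs w locate s ((n + 1) * 80) fun s' => AgreeOff [6, 7, 8, 9, 10, 11] s s' ∧
      ∃ a b, s'.reg 6 = a ∧ s'.reg 7 = b ∧ a ≤ X.N ∧ b ≤ X.N ∧
        (∀ d < X.N, d < a ↔ X.key d < s.rreg 0) ∧ ∀ d < X.N, d < b ↔ X.key d ≤ s.rreg 1 := by
  refine Runs.mono (Runs.seq (runs_keySearch hw hn hs (P := fun v => X.key v < s.rreg 0) ?_ ?_) ?_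
    (T₂ := 2 + ((n + 1) * 31 + 2))) ?_ fun _ h => h
  · intro s' v hs' h
    rw [eval_eq (eval_rle (by omega)) (eval_lit (by omega)) (by omega), hs'.rreg_zero, h]
    by_cases h' : s.rreg 0 ≤ X.key v <;> simp [h', not_lt.2, not_le.1]
  · intro u v huv hv h
    exact (X.key_mono u v huv hv).trans_lt h
  · rintro s₁ ⟨hs₁, a, g1, g2, g3⟩
    refine Runs.seq (Runs.assign (eval_reg g1) (Q := fun s' => s' = _) rfl) ?_
    rintro _ rfl
    have hs₂ := hs₁.update 6 a (S := [6, 8, 9, 10, 11])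
    refine Runs.seq (runs_keySearch hw hn (hs.of_agreeOff hs₂) (P := fun v => X.key v ≤ s.rreg 1)
      ?_ ?_) ?_
    · intro s' v hs' h
      rw [eval_rle (by omega), (hs₂.trans hs' (S := [6, 8, 9, 10, 11])).rreg_one, h]
      simp
    · intro u v huv hv h
      exact (X.key_mono u v huv hv).trans h
    · rintro s₃ ⟨hs₃, b, g1', g2', g3'⟩
      have g6 : s₃.reg 6 = a := by
        rw [hs₃.reg 6 (by simp)]
        simp
      exact Runs.assign (eval_reg g1') ⟨(hs₂.trans hs₃ (S := [6, 7, 8, 9, 10, 11])).update 7 _,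
        a, b, by simpa using g6, by simp, g2, g2', g3, g3'⟩
  · simp only [Expr.cost]
    omega

/-- The boundaries are `⌈a / B⌉ * B` and `⌊b / B⌋ * B`, each less than `B` away from its endpoint.
The bound `min a b ≤ p` matters only for inverted queries, where it keeps the range empty during the
extension. -/
lemma runs_startRange (hw : 20 * (X.N + 1) + 2 * (X.N + 1) ^ 2 < 2 ^ w) (hB : 0 < B)
    (hBN : B ≤ X.N) (hK : K = X.N / B + 1) (hs : Ready X B K s) {a b : ℕ} (h6 : s.reg 6 = a)
    (h7 : s.reg 7 = b) (h0 : s.reg 0 = 0) (ha : a ≤ X.N) (hb : b ≤ X.N) :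
    Runs w startRange s 50 fun s' => AgreeOff [0, 4, 5, 14, 16] s s' ∧
      ∃ p q, s'.reg 4 = p ∧ s'.reg 5 = q ∧ p ≤ q ∧ q ≤ b ∧ p - a ≤ B ∧ b - q ≤ B ∧
        min a b ≤ p ∧ s'.reg 0 = X.wedges p q := by
  refine Runs.mono (Runs.seq (Runs.assign (eval_div (eval_sub (eval_add (eval_reg h6)
    (eval_reg hs.reg_two) (by omega)) (eval_lit (by omega)) (by omega)) (eval_reg hs.reg_two)
    (by omega)) (Q := fun s' => s' = _) rfl) ?_ (T₂ := 4 + (4 + 24))) (by simp [Expr.cost])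
    fun _ h => h
  rintro _ rfl
  have hs₁ := (AgreeOff.refl [] s).update 14 ((a + B - 1) / B) (S := [14])
  refine Runs.seq (Runs.assign (eval_div (eval_reg ((hs₁.reg 7 (by simp)).trans h7))
    (eval_reg (hs.of_agreeOff hs₁).reg_two) (by omega)) (Q := fun s' => s' = _) rfl) ?_
  rintro _ rfl
  have hs₂ := hs₁.update 16 (b / B) (S := [14, 16])
  have h14 : Function.update (Function.update s.reg 14 ((a + B - 1) / B)) 16 (b / B) 14 =
    (a + B - 1) / B := by simp
  have h16 : Function.update (Function.update s.reg 14 ((a + B - 1) / B)) 16 (b / B) 16 =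
    b / B := by simp
  have hi := Nat.div_add_mod (a + B - 1) B
  have hi' := Nat.mod_lt (a + B - 1) hB
  have hj := Nat.div_add_mod b B
  have hj' := Nat.mod_lt b hB
  have hjK : b / B ≤ X.N / B := Nat.div_le_div_right hb
  have hKN : X.N / B ≤ X.N := Nat.div_le_self _ _
  generalize (a + B - 1) / B = i at *
  generalize b / B = j at *
  have hc : (Expr.op .lt (.reg 16) (.reg 14)).eval w
      { s with reg := Function.update (Function.update s.reg 14 i) 16 j } =
        if j < i then 1 else 0 := eval_lt (eval_reg h16) (eval_reg h14) (by omega)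
  refine Runs.ite (fun h => ?_) (fun h => ?_)
  -- No block boundary lies in `[a, b]`, so `b - a < B` (truncated). Starting from the empty range
  -- at `b`, only the left end has to move.
  · rw [hc] at h
    have hji : j < i := by simpa using h
    have hmul : B * (j + 1) ≤ B * i := Nat.mul_le_mul_left B hji
    rw [mul_add, mul_one] at hmul
    refine Runs.mono (Runs.seq (Runs.assign (eval_reg ((hs₂.reg 7 (by simp)).trans h7))
      (Q := fun s' => s' = _) rfl) ?_ (T₂ := 2)) (by simp [Expr.cost]) fun _ h => h
    rintro _ rfl
    have hs₃ := hs₂.update 4 b (S := [4, 14, 16])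
    refine Runs.assign (eval_reg ((hs₃.reg 7 (by simp)).trans h7))
      ⟨hs₃.update 5 _, b, b, by simp, by simp, le_rfl, le_rfl, by omega, by omega, min_le_right _ _, ?_⟩
    rw [X.wedges_self b b le_rfl]
    simpa using h0
  · rw [hc] at h
    have hij : i ≤ j := by simpa using h
    have hmul : B * i ≤ B * j := Nat.mul_le_mul_left B hij
    have hmul' : i * K + j ≤ (X.N + 1) ^ 2 + X.N := by
      rw [sq]
      exact Nat.add_le_add (Nat.mul_le_mul (by omega) (by omega)) (by omega)
    have hK' : i * K ≤ i * K + j := Nat.le_add_right _ _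
    rw [mul_comm B i] at *
    rw [mul_comm B j] at *
    refine Runs.mono (Runs.seq (Runs.assign (eval_mul (eval_reg h14)
      (eval_reg (hs.of_agreeOff hs₂).reg_two) (by omega))
      (Q := fun s' => s' = _) rfl) ?_ (T₂ := 4 + 12)) (by simp [Expr.cost]) fun _ h => h
    rintro _ rfl
    have hs₃ := hs₂.update 4 (i * B) (S := [4, 14, 16])
    refine Runs.mono (Runs.seq (Runs.assign (eval_mul (eval_reg (a := j) (by simp))
      (eval_reg (hs.of_agreeOff hs₃).reg_two) (by omega))
      (Q := fun s' => s' = _) rfl) ?_ (T₂ := 12)) (by simp [Expr.cost]) fun _ h => h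
    rintro _ rfl
    have hs₄ := hs₃.update 5 (j * B) (S := [4, 5, 14, 16])
    have hr := hs.of_agreeOff hs₄
    refine Runs.load (eval_add (eval_add (eval_lit (by omega)) (eval_mul (eval_lit (by omega))
      (eval_reg hr.reg_one) (by omega)) (by omega)) (eval_add (eval_mul (eval_reg (a := i) (by simp))
      (eval_reg hr.reg_three) (by omega)) (eval_reg (a := j) (by simp)) (by omega)) (by omega))
      (hs.stored.table i (by omega) j (by omega)) ⟨hs₄.update 0 _, i * B, j * B, by simp, by simp,
        hmul, by omega, by omega, by omega, by omega, by simp⟩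

/-- There are at most `B` extensions on either side, each of cost `O(n)`. The program contains no
store, so the memory comes back unchanged. -/
theorem runs_query (hw : 20 * (X.N + 1) + 2 * (X.N + 1) ^ 2 < 2 ^ w) (hn : X.N < 2 ^ n)
    (hB : 0 < B) (hBN : B ≤ X.N) (hK : K = X.N / B + 1) (hs : Stored X B K s.mem s.rmem)
    (h0 : s.reg 0 = 0) :
    Runs w query s ((n + 1) * 700 * (B + 1)) fun s' => s'.mem = s.mem ∧ s'.rmem = s.rmem ∧
      ∃ a b, a ≤ X.N ∧ b ≤ X.N ∧ (∀ d < X.N, d < a ↔ X.key d < s.rreg 0) ∧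
        (∀ d < X.N, d < b ↔ X.key d ≤ s.rreg 1) ∧ s'.reg 0 = X.wedges a b := by
  have hw' : 10 * X.N + X.N * X.N + 10 < 2 ^ w := by nlinarith
  refine Runs.mono (Runs.seq (Runs.load (eval_lit (by omega)) hs.size (Q := fun s' => s' = _) rfl) ?_
    (T₂ := 2 + (2 + ((n + 1) * 80 + (50 + (((n + 1) * 270 * B + 10) + ((n + 1) * 270 * B + 10)))))))
    ?_ fun _ h => h
  · rintro _ rfl
    refine Runs.seq (Runs.load (eval_lit (by omega)) hs.block (Q := fun s' => s' = _) rfl) ?_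
    rintro _ rfl
    refine Runs.seq (Runs.load (eval_lit (by omega)) hs.width (Q := fun s' => s' = _) rfl) ?_
    rintro _ rfl
    have hs₁ := (((AgreeOff.refl [] s).update 1 X.N (S := [1])).update 2 B (S := [1, 2])).update 3 K
      (S := [1, 2, 3])
    have hr₁ : Ready X B K { s with reg := Function.update (Function.update
      (Function.update s.reg 1 X.N) 2 B) 3 K } := ⟨hs, by simp, by simp, by simp⟩
    refine Runs.seq (runs_locate (by omega) hn hr₁) ?_
    rintro s₂ ⟨hs₂, a, b, h6, h7, ha, hb, hka, hkb⟩
    have hr₂ := hr₁.of_agreeOff hs₂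
    have hs₂' : AgreeOff [1, 2, 3, 6, 7, 8, 9, 10, 11] s s₂ := hs₁.trans hs₂
    refine Runs.seq (runs_startRange hw hB hBN hK hr₂ h6 h7 ((hs₂'.reg 0 (by simp)).trans h0)
      ha hb) ?_
    rintro s₃ ⟨hs₃, p, q, h4, h5, hpq, hqb, hpa, hbq, hap, hW⟩
    have hr₃ := hr₂.of_agreeOff hs₃
    refine Runs.seq (runs_extendLeft hw' hn (by omega) B s₃ p hr₃ h4 h5
      ((hs₃.reg 6 (by simp)).trans h6) hW hpq hpa) ?_
    rintro s₄ ⟨hs₄, h4', hW'⟩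
    refine Runs.mono (runs_extendRight hw' hn hb B s₄ q (hr₃.of_agreeOff hs₄) h4'
      ((hs₄.reg 5 (by simp)).trans h5) ((hs₄.reg 7 (by simp)).trans
        ((hs₃.reg 7 (by simp)).trans h7)) hW' (by omega) (by omega) hbq) le_rfl ?_
    rintro s₅ ⟨hs₅, hW''⟩
    refine ⟨by rw [hs₅.mem, hs₄.mem, hs₃.mem, hs₂.mem],
      by rw [hs₅.rmem, hs₄.rmem, hs₃.rmem, hs₂.rmem], a, b, ha, hb, hka, hkb, ?_⟩
    rw [hW'', max_eq_left hqb]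
    -- If `b < a`, both the computed range and the requested one are empty.
    rcases le_or_gt a b with hab | hab
    · rw [min_eq_left (by omega)]
    · rw [X.wedges_self a b hab.le, X.wedges_self _ b (by omega)]
  · simp only [Expr.cost]
    rw [mul_add _ B]
    have : (n + 1) * 270 * B * 2 ≤ (n + 1) * 700 * B := by nlinarith [Nat.zero_le ((n + 1) * B)]
    omega

end

end WordRAM

/-! ### The stored words: positions, size and word length. -/

namespace WordRAM

/-- The words of the data structure. -/
def wordList (X : DartList) (B K : ℕ) : List ℕ :=
  [X.N, B, K] ++ ((List.range X.N).map X.rev ++ ((List.range X.N).map X.fst ++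
    ((List.range X.N).map X.lst ++
      (List.range (K * K)).map fun t => X.wedges (t / K * B) (t % K * B))))

lemma stored_wordList (X : DartList) (B K : ℕ) :
    Stored X B K (wordList X B K) ((List.range X.N).map X.key) where
  size := rfl
  block := rfl
  width := rfl
  rev d hd := by
    rw [wordList, List.getElem?_append_right (by simp), List.getElem?_append_left (by simp; omega)]
    simp [hd]
  fst d hd := by
    rw [wordList, List.getElem?_append_right (by simp; omega),
      List.getElem?_append_right (by simp; omega), List.getElem?_append_left (by simp; omega)]
    simp only [List.length_cons, List.length_nil, List.length_map, List.length_range]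
    rw [show 3 + X.N + d - (0 + 1 + 1 + 1) - X.N = d by omega]
    simp [hd]
  lst d hd := by
    rw [wordList, List.getElem?_append_right (by simp; omega),
      List.getElem?_append_right (by simp; omega), List.getElem?_append_right (by simp; omega),
      List.getElem?_append_left (by simp; omega)]
    simp only [List.length_cons, List.length_nil, List.length_map, List.length_range]
    rw [show 3 + 2 * X.N + d - (0 + 1 + 1 + 1) - X.N - X.N = d by omega]
    simp [hd]
  table i hi j hj := by
    rw [wordList, List.getElem?_append_right (by simp; omega),
      List.getElem?_append_right (by simp; omega), List.getElem?_append_right (by simp; omega),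
      List.getElem?_append_right (by simp; omega)]
    simp only [List.length_cons, List.length_nil, List.length_map, List.length_range]
    have hij : i * K + j < K * K := by
      have := Nat.mul_le_mul_right K (Nat.succ_le_of_lt hi)
      rw [Nat.succ_mul] at this
      omega
    rw [show 3 + 3 * X.N + (i * K + j) - (0 + 1 + 1 + 1) - X.N - X.N - X.N = i * K + j by omega]
    have h1 : (i * K + j) / K = i := by
      rw [Nat.add_comm, Nat.add_mul_div_right _ _ (by omega), Nat.div_eq_of_lt hj, Nat.zero_add]
    have h2 : (i * K + j) % K = j := by
      rw [Nat.add_comm, Nat.add_mul_mod_self_right, Nat.mod_eq_of_lt hj]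
    simp [List.getElem?_range hij, h1, h2]
  key d hd := by simp [hd]

lemma wordList_lt {X : DartList} {B K w : ℕ} (hw : 20 * (X.N + 1) + 2 * (X.N + 1) ^ 2 < 2 ^ w)
    (hBN : B ≤ X.N) (hK : K = X.N / B + 1) : ∀ a ∈ wordList X B K, a < 2 ^ w := by
  have hKN : X.N / B ≤ X.N := Nat.div_le_self _ _
  intro a ha
  simp only [wordList, List.mem_append, List.mem_cons, List.not_mem_nil, or_false, List.mem_map,
    List.mem_range] at ha
  rcases ha with (rfl | rfl | rfl) | ⟨d, hd, rfl⟩ | ⟨d, hd, rfl⟩ | ⟨d, hd, rfl⟩ | ⟨t, ht, rfl⟩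
  · omega
  · omega
  · omega
  · have := X.rev_lt d hd
    omega
  · have := X.fst_le hd
    omega
  · have := X.lst_le d hd
    omega
  -- Only the right end of a table range has to be at most `N` for `wedges_le`, so the row index
  -- needs no bound.
  · have h1 : t % K ≤ X.N / B := by
      have := Nat.mod_lt t (hK ▸ Nat.succ_pos _ : 0 < K)
      omega
    have h2 : t % K * B ≤ X.N := (Nat.mul_le_mul_right B h1).trans (Nat.div_mul_le_self _ _)
    have h3 := X.wedges_le (p := t / K * B) h2
    nlinarith

lemma length_wordList (X : DartList) (B K : ℕ) :
    (wordList X B K).length = 3 + 3 * X.N + K * K := by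
  simp [wordList]
  omega

end WordRAM

/-! ### Numerical estimates and the theorem. -/

/-- From `2 ^ (clog - 1) < x` and `log 2 > 1 / 2`. -/
lemma Nat.clog_two_le_two_mul_log {x : ℕ} (hx : 2 ≤ x) :
    (Nat.clog 2 x : ℝ) ≤ 2 * Real.log x + 1 := by
  have h1 : 2 ^ (Nat.clog 2 x).pred < x := Nat.pow_pred_clog_lt_self one_lt_two (by omega)
  have h2 : ((Nat.clog 2 x).pred : ℝ) * Real.log 2 ≤ Real.log x := by
    rw [← Real.log_pow]
    exact Real.log_le_log (by positivity) (by exact_mod_cast h1.le)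
  have h3 : (Nat.clog 2 x : ℝ) ≤ ((Nat.clog 2 x).pred : ℝ) + 1 := by
    exact_mod_cast (by rw [Nat.pred_eq_sub_one]; omega :
      Nat.clog 2 x ≤ (Nat.clog 2 x).pred + 1)
  have h4 := Real.log_two_gt_d9
  nlinarith [Nat.cast_nonneg (α := ℝ) (Nat.clog 2 x).pred]

theorem theorem1 :
    ∃ (p : WordRAM.Prog) (k c : ℕ) (C : ℝ),
      ∀ (V : Type*) [Fintype V] (G : SimpleGraph V) (A : V → ℝ) (m : ℕ), m = G.edgeSet.ncard →
      ∀ lam : ℝ, 1 ≤ lam → lam ≤ Real.sqrt m →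
      ∀ w : ℕ, k * Nat.clog 2 (m + 2) ≤ w →
      ∃ D : WordRAM.DataStructure w,
        (D.space : ℝ) ≤ C * Real.log (m + 2) ^ c * ((m : ℝ) ^ 2 / lam ^ 2) ∧
        ∀ x₁ x₂ : ℝ, ∃ t : ℕ,
          D.Answers p x₁ x₂ (rangeSubgraphCount G A wedge x₁ x₂) t ∧
          (t : ℝ) ≤ C * Real.log (m + 2) ^ c * lam := by
  -- The word length factor `6` comes from `81 (m + 2)² ≤ (m + 2)⁶`, valid as `m + 2 ≥ 3`. The
  -- constant is `7000 = 5 * 700 * 2`: `clog + 2 ≤ 5 log (m + 2)`, `700` from `runs_query`, and `B +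
  -- 1 ≤ 2λ`. It far exceeds what the space bound needs.
  refine ⟨WordRAM.query, 6, 1, 7000, fun V _ G A m hm lam h1 hlam w hw => ?_⟩
  obtain ⟨X, hXN, hX⟩ := exists_dartList G A
  rw [← hm] at hXN
  have hlam2 : lam ^ 2 ≤ m := (Real.le_sqrt' (by linarith)).1 hlam
  have hm1 : (1 : ℝ) ≤ m := by nlinarith
  have hlm : lam ≤ m := by nlinarith
  have hm1' : 1 ≤ m := by exact_mod_cast hm1
  set B := ⌊lam⌋₊
  have hB : 0 < B := Nat.floor_pos.2 h1
  have hBlam : (B : ℝ) ≤ lam := Nat.floor_le (by linarith)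
  have hBlam' : lam < B + 1 := Nat.lt_floor_add_one lam
  have hB1 : (1 : ℝ) ≤ B := by exact_mod_cast hB
  have hBN : B ≤ X.N := by
    have : B ≤ m := by exact_mod_cast hBlam.trans hlm
    omega
  set K := X.N / B + 1 with hK
  -- The hypotheses on `lam` force `m ≥ 1`, and `e < 3`. This lets the logarithm absorb additive
  -- constants.
  have hlog : 1 ≤ Real.log (m + 2) := by
    rw [Real.le_log_iff_exp_le (by positivity)]
    linarith [Real.exp_one_lt_d9]
  have hclog : m + 2 ≤ 2 ^ Nat.clog 2 (m + 2) := Nat.le_pow_clog one_lt_two _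
  have hpoly : ∀ x : ℕ, 20 * (2 * x + 1) + 2 * (2 * x + 1) ^ 2 < 81 * (x + 2) ^ 2 := by
    intro x
    ring_nf
    omega
  have hww : 20 * (X.N + 1) + 2 * (X.N + 1) ^ 2 < 2 ^ w := by
    calc 20 * (X.N + 1) + 2 * (X.N + 1) ^ 2 < 81 * (m + 2) ^ 2 := by rw [hXN]; exact hpoly m
      _ ≤ (m + 2) ^ 4 * (m + 2) ^ 2 :=
        Nat.mul_le_mul_right _ ((Nat.pow_le_pow_left (by omega : 3 ≤ m + 2) 4))
      _ = (m + 2) ^ 6 := by ring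
      _ ≤ (2 ^ Nat.clog 2 (m + 2)) ^ 6 := by gcongr
      _ = 2 ^ (6 * Nat.clog 2 (m + 2)) := by rw [← pow_mul, mul_comm]
      _ ≤ 2 ^ w := by gcongr; omega
  refine ⟨⟨WordRAM.wordList X B K, (List.range X.N).map X.key, WordRAM.wordList_lt hww hBN hK⟩,
    ?_, fun x₁ x₂ => ?_⟩
  -- Since `λ < B + 1 ≤ 2B`, the quotient `2m / B` is at most `4m / λ`; the extra boundary costs `1
  -- ≤ m / λ`.
  · have hKR : (K : ℝ) ≤ 5 * (m / lam) := by
      have e1 : ((X.N / B : ℕ) : ℝ) ≤ X.N / B := Nat.cast_div_le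
      have e2 : (X.N : ℝ) / B ≤ 4 * (m / lam) := by
        rw [hXN, ← mul_div_assoc, div_le_div_iff₀ (by linarith) (by linarith)]
        push_cast
        nlinarith
      have e3 : 1 ≤ m / lam := (one_le_div (by linarith)).2 hlm
      rw [hK]
      push_cast
      linarith
    -- This is where `λ ≤ √m` pays for the arrays of linear size.
    have hsq : (m : ℝ) ≤ m ^ 2 / lam ^ 2 := by
      rw [le_div_iff₀ (by positivity), sq (m : ℝ)]
      gcongr
    have hKK : (K : ℝ) * K ≤ 25 * (m ^ 2 / lam ^ 2) := by
      rw [← div_pow]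
      nlinarith [Nat.cast_nonneg (α := ℝ) K]
    rw [WordRAM.DataStructure.space, WordRAM.length_wordList, List.length_map, List.length_range,
      hXN, pow_one]
    push_cast
    have : (m : ℝ) ^ 2 / lam ^ 2 ≤ Real.log (m + 2) * (m ^ 2 / lam ^ 2) :=
      le_mul_of_one_le_left (by positivity) hlog
    nlinarith
  · have hn : X.N < 2 ^ (Nat.clog 2 (m + 2) + 1) := by
      rw [pow_succ]
      omega
    obtain ⟨s', t, hexec, ht, hmem, hrmem, a, b, ha, hb, hka, hkb, hW⟩ :=
      WordRAM.runs_query (s := WordRAM.DataStructure.start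
        ⟨WordRAM.wordList X B K, (List.range X.N).map X.key, WordRAM.wordList_lt hww hBN hK⟩ x₁ x₂)
        hww hn hB hBN hK (WordRAM.stored_wordList X B K) rfl
    refine ⟨t, ⟨s', hexec, ?_, hmem, hrmem⟩, ?_⟩
    · rw [hW]
      exact hX x₁ x₂ a b ha hb (by simpa [WordRAM.DataStructure.start] using hka)
        (by simpa [WordRAM.DataStructure.start] using hkb)
    · have hc := Nat.clog_two_le_two_mul_log (show 2 ≤ m + 2 by omega)
      push_cast at hc
      have htR : (t : ℝ) ≤ (Nat.clog 2 (m + 2) + 1 + 1) * 700 * (B + 1) := by exact_mod_cast ht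
      calc (t : ℝ) ≤ (Nat.clog 2 (m + 2) + 1 + 1) * 700 * (B + 1) := htR
        _ ≤ (5 * Real.log (m + 2)) * 700 * (2 * lam) := by
            gcongr <;> linarith
        _ = 7000 * Real.log (m + 2) ^ 1 * lam := by ring
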